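/- Let $N\ge 3$. For $x\in\mathbb{R}^N$ write $|x|$ for the Euclidean norm, let $\omega_N$ be the volume of the unit ball of $\mathbb{R}^N$, and let $|\rho|_q$ be the norm of $\rho$ in $L^q(\mathbb{R}^N)$. There exist constants $\gamma\in(0,\tfrac1N)$ and $C>0$, depending only on $N$, such that the following holds. Let $2N<q<\infty$, $x_0\in\mathbb{R}^N$, $R>0$, let $\rho\in L^q(\mathbb{R}^N)\cap C^1(\mathbb{R}^N)$, and let $u\in C^3(\mathbb{R}^N)$ be strictly spacelike, that is, $|u(x)-u(y)|<|x-y|$ for all $x\neq y$ and $|\nabla u|<1$ everywhere. Suppose that $u$ solves $$-\operatorname{div}\left(\frac{\nabla u}{\sqrt{1-|\nabla u|^2}}\right)=\rho\quad\text{in }\mathbb{R}^N,\qquad \lim_{|x|\to\infty}u(x)=0 .$$ Set $v=\sqrt{1-|\nabla u|^2}$, $\beta=\frac{2N}{q}$, $c(\rho)=\frac94|\rho|_q^2$ and, for $r>0$, $K_r(x_0)=\{x\in\mathbb{R}^N:\ [\,|x-x_0|^2-(u(x)-u(x_0))^2]^{1/2}<r\}$. Then all the integrals below are finite and $$\omega_N\,v^\gamma(x_0)\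 \ge\ e^{-\gamma/4}R^{-N}\int_{K_R(x_0)}v^{\gamma+1}\,dx\;-\;c(\rho)\,R\left(\frac2q\right)^{\frac{q-2}{2}}\int_0^R s^{-\beta}\left[\frac q2\,\omega_N^{\frac2q}+\frac{c(\rho)}{1-\beta}\,s^{2-\beta}\right]^{\frac{q-2}{2}}ds\;+\;C\,R^{2-N}e^{-\gamma/4}\int_{K_{R/2}(x_0)}\sum_{i,j=1}^N u_{ij}^2\,dx .$$ -/

import Mathlib

open MeasureTheory Filter Topology

noncomputable section

namespace BornInfeld

/-- The Euclidean space `ℝ^N`. -/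
abbrev E (N : ℕ) : Type := EuclideanSpace ℝ (Fin N)

/-- The `i`-th partial derivative of a real function on `ℝ^N`. -/
def partialD {N : ℕ} (i : Fin N) (f : E N → ℝ) (x : E N) : ℝ :=
  fderiv ℝ f x (EuclideanSpace.single i 1)

/-- The second partial derivative `f_ij`. -/
def partialD2 {N : ℕ} (i j : Fin N) (f : E N → ℝ) (x : E N) : ℝ :=
  partialD j (partialD i f) x

/-- The divergence of a vector field on `ℝ^N`. -/
def divergence {N : ℕ} (F : E N → E N) (x : E N) : ℝ :=
  ∑ i, partialD i (fun y => F y i) x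

/-- The function `v = √(1 - |∇u|²)`. -/
def v {N : ℕ} (u : E N → ℝ) (x : E N) : ℝ :=
  Real.sqrt (1 - ‖gradient u x‖ ^ 2)

/-- The Lorentz mean curvature operator `Q⁻(u) = - div (∇u / √(1 - |∇u|²))`. -/
def Qminus {N : ℕ} (u : E N → ℝ) (x : E N) : ℝ :=
  -divergence (fun y => (v u y)⁻¹ • gradient u y) x

/-- `u` is strictly spacelike on `ℝ^N`: it is spacelike (hence Lipschitz), of class `C¹`, and
`|∇u| < 1` everywhere. -/
structure StrictlySpacelike {N : ℕ} (u : E N → ℝ) : Prop where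
  spacelike : ∀ x y, x ≠ y → |u x - u y| < ‖x - y‖
  contDiff : ContDiff ℝ 1 u
  norm_gradient_lt : ∀ x, ‖gradient u x‖ < 1

/-- `u` solves the electrostatic Born-Infeld problem with datum `ρ` pointwise:
`Q⁻(u) = ρ` in `ℝ^N` and `u(x) → 0` as `|x| → ∞`. -/
structure SolvesBI {N : ℕ} (ρ u : E N → ℝ) : Prop where
  eqn : ∀ x, Qminus u x = ρ x
  decay : Tendsto u (cocompact (E N)) (𝓝 0)

/-- The Lorentz distance `l(x, x₀) = (|x - x₀|² - (u(x) - u(x₀))²)^(1/2)` along the graph of `u`. -/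
def lorentzDist {N : ℕ} (u : E N → ℝ) (x x₀ : E N) : ℝ :=
  Real.sqrt (‖x - x₀‖ ^ 2 - (u x - u x₀) ^ 2)

/-- The projection `K_R(x₀)` on `ℝ^N` of the Lorentz ball of radius `R`. -/
def K {N : ℕ} (u : E N → ℝ) (R : ℝ) (x₀ : E N) : Set (E N) :=
  {x | lorentzDist u x x₀ < R}

/-- The volume `ω_N` of the unit ball of `ℝ^N`. -/
def omega (N : ℕ) : ℝ := (volume (Metric.ball (0 : E N) 1)).toReal

/-- The constant `c(ρ) = (9/4) |ρ|_q²`. -/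
def cRho {N : ℕ} (q : ℝ) (ρ : E N → ℝ) : ℝ :=
  9 / 4 * (eLpNorm ρ (ENNReal.ofReal q) volume).toReal ^ 2

/-- The function `s ↦ s^(-β) [ (q/2) ω_N^(2/q) + c/(1-β) s^(2-β) ]^((q-2)/2)`. -/
def errorIntegrand (N : ℕ) (q β c s : ℝ) : ℝ :=
  s ^ (-β) * (q / 2 * omega N ^ (2 / q) + c / (1 - β) * s ^ (2 - β)) ^ ((q - 2) / 2)

end BornInfeld

end

/-! The estimate is a monotonicity formula for Lorentz balls, weighted by `v^γ`, on the graph of `u`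
in Minkowski space, whose volume element is `v dx`. Let `l` be the Lorentz distance to the base
point, `P` the normal part of the position vector, `H` the mean curvature and `|A|` the norm of the
second fundamental form. Two fields carry the argument: `radialField`, `V`, of divergence `v (N + H
P)`, and `curvField`, `W`, of divergence `|A|² - H²`. The field `φ(l²) v^γ V - γ Ψ(l²) v^(γ+1) W`
has compact support, because `u` is bounded, so its divergence integrates to zero. With `Ψ' = -φ/2`
the terms in `⟨D²u ∇u, x - x₀⟩` cancel, and no derivative of `H` appears (`sum_partialD_testField`).

For small `γ` the coefficient of `Ψ` is at most `γ v^(γ+1) (-γ |A|² + (2N+1) H²)`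
(`coeffSecond_le`); this yields the Hessian term. The kernel behind `φ` is `N σ^(-N-1) e^(-κσ)` on
`[ε, R)`. The power makes the leading terms cancel up to one contribution of `K_R` and one of `K_ε`;
the exponential, with `κ = γ/(4R)`, pays for the term in `γ H l` and is the origin of `e^(-γ/4)`
(`kernel_bound`). As `ε → 0` the average over `K_ε` tends to `ω_N v^γ(x₀)`, since the rescaled `K_ε`
converge to an ellipsoid of volume `ω_N / v(x₀)` (`tendsto_integral_K_div`).

What remains is an error in `H² = ρ²`. Hölder bounds it by `|ρ|_q²` times a power of the density
`D(s) = s^(-N) ∫_{K_s} v`, with weight `s^(-β)`, integrable because `q > 2N` (`ball_estimate`). The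
same inequality with `γ = 0` is a nonlinear Gronwall inequality for `D`, and solving it gives the
bracket in the statement (`density_rpow_le`). -/

noncomputable section

namespace BornInfeld

variable {N : ℕ}

/-! ### Partial derivatives and the divergence theorem for compactly supported fields -/

section Calculus

variable {f g : E N → ℝ} {x : E N} (i j : Fin N)

lemma partialD_add (hf : DifferentiableAt ℝ f x) (hg : DifferentiableAt ℝ g x) :
    partialD i (fun y => f y + g y) x = partialD i f x + partialD i g x := by
  simp [partialD, fderiv_fun_add hf hg]

lemma partialD_sub (hf : DifferentiableAt ℝ f x) (hg : DifferentiableAt ℝ g x) :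
    partialD i (fun y => f y - g y) x = partialD i f x - partialD i g x := by
  simp [partialD, fderiv_fun_sub hf hg]

lemma partialD_mul (hf : DifferentiableAt ℝ f x) (hg : DifferentiableAt ℝ g x) :
    partialD i (fun y => f y * g y) x = f x * partialD i g x + g x * partialD i f x := by
  simp [partialD, fderiv_fun_mul hf hg]

lemma partialD_sum {ι : Type*} (s : Finset ι) {F : ι → E N → ℝ}
    (hF : ∀ k ∈ s, DifferentiableAt ℝ (F k) x) :
    partialD i (fun y => ∑ k ∈ s, F k y) x = ∑ k ∈ s, partialD i (F k) x := by
  simp [partialD, fderiv_fun_sum hF]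

lemma partialD_comp {h : ℝ → ℝ} {h' : ℝ} (hh : HasDerivAt h h' (f x))
    (hf : DifferentiableAt ℝ f x) :
    partialD i (fun y => h (f y)) x = h' * partialD i f x := by
  have := hh.comp_hasFDerivAt x hf.hasFDerivAt
  simp only [partialD]
  erw [this.fderiv]
  simp

lemma partialD_const (c : ℝ) : partialD i (fun _ : E N => c) x = 0 := by
  simp [partialD]

lemma partialD_coord (x₀ : E N) :
    partialD i (fun y : E N => y j - x₀ j) x = if i = j then 1 else 0 := by
  have h : HasFDerivAt (fun y : E N => y j - x₀ j)
      (EuclideanSpace.proj j : E N →L[ℝ] ℝ) x :=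
    (EuclideanSpace.proj j : E N →L[ℝ] ℝ).hasFDerivAt.sub_const _
  simp only [partialD, h.fderiv]
  simp [eq_comm]

lemma contDiff_coord (x₀ : E N) {n : WithTop ℕ∞} : ContDiff ℝ n (fun y : E N => y j - x₀ j) :=
  (EuclideanSpace.proj j : E N →L[ℝ] ℝ).contDiff.sub contDiff_const

lemma contDiff_partialD {m n : WithTop ℕ∞} (hf : ContDiff ℝ n f) (hmn : m + 1 ≤ n) :
    ContDiff ℝ m (partialD i f) :=
  (hf.fderiv_right hmn).clm_apply contDiff_const

lemma partialD_comm (hf : ContDiff ℝ 2 f) :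
    partialD j (partialD i f) x = partialD i (partialD j f) x := by
  have hs : IsSymmSndFDerivAt ℝ f x :=
    hf.contDiffAt.isSymmSndFDerivAt (by simp)
  have hd : DifferentiableAt ℝ (fderiv ℝ f) x :=
    ((hf.fderiv_right (m := 1) (by norm_num)).differentiable (by simp)).differentiableAt
  have key : ∀ k l : Fin N, partialD k (partialD l f) x =
      fderiv ℝ (fderiv ℝ f) x (EuclideanSpace.single k 1) (EuclideanSpace.single l 1) := by
    intro k l
    have : HasFDerivAt (partialD l f)
        ((fderiv ℝ (fderiv ℝ f) x).flip (EuclideanSpace.single l 1)) x := by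
      have := hd.hasFDerivAt.clm_apply
        (hasFDerivAt_const (EuclideanSpace.single l (1 : ℝ) : E N) x)
      simp only [ContinuousLinearMap.comp_zero, zero_add] at this
      exact this
    simp only [partialD] at this ⊢
    rw [this.fderiv]
    simp
  rw [key, key]
  exact hs _ _

lemma gradient_apply : gradient f x i = partialD i f x := by
  have h1 : inner ℝ (gradient f x) (EuclideanSpace.single i (1 : ℝ)) = partialD i f x := by
    rw [← InnerProductSpace.toDual_apply_apply, toDual_gradient]
    rfl
  rw [← h1, EuclideanSpace.inner_single_right]
  simp

lemma norm_gradient_sq : ‖gradient f x‖ ^ 2 = ∑ i, partialD i f x ^ 2 := by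
  rw [EuclideanSpace.norm_sq_eq]
  simp [gradient_apply]

lemma integral_partialD_eq_zero (hf : ContDiff ℝ 1 f) (hc : HasCompactSupport f) :
    ∫ x, partialD i f x = 0 := by
  have hcont : Continuous (partialD i f) :=
    (contDiff_partialD (m := 0) i hf (by simp)).continuous
  have hc' : HasCompactSupport (partialD i f) := hc.fderiv_apply ℝ _
  -- Integration by parts against the constant function 1.
  have := integral_mul_fderiv_eq_neg_fderiv_mul_of_integrable (μ := (volume : Measure (E N)))
    (f := fun _ => (1 : ℝ)) (g := f) (v := EuclideanSpace.single i 1) (by simp)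
    (by simp only [one_mul]; exact hcont.integrable_of_hasCompactSupport hc')
    (by simpa using hf.continuous.integrable_of_hasCompactSupport hc)
    (fun x _ => differentiableAt_const _)
    (fun x _ => hf.differentiable (by simp) x)
  simpa [partialD] using this

lemma integral_sum_partialD_eq_zero {Z : Fin N → E N → ℝ} (hZ : ∀ i, ContDiff ℝ 1 (Z i))
    (hc : ∀ i, HasCompactSupport (Z i)) : ∫ x, ∑ i, partialD i (Z i) x = 0 := by
  rw [integral_finsetSum _ fun i _ => ?_]
  · exact Finset.sum_eq_zero fun i _ => integral_partialD_eq_zero i (hZ i) (hc i)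
  · exact ((contDiff_partialD (m := 0) i (hZ i) (by simp)).continuous).integrable_of_hasCompactSupport
      ((hc i).fderiv_apply ℝ _)

end Calculus

/-! ### Extrinsic geometry of a spacelike graph -/

section Geometry

/-- The vector `D²u ∇u`. -/
def hessGrad (u : E N → ℝ) (i : Fin N) (x : E N) : ℝ :=
  ∑ j, partialD2 i j u x * partialD j u x

/-- The quadratic form `⟨∇u, D²u ∇u⟩`. -/
def hessGradGrad (u : E N → ℝ) (x : E N) : ℝ :=
  ∑ i, partialD i u x * hessGrad u i x

/-- The field `∇u / √(1 - |∇u|²)`. -/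
def normalField (u : E N → ℝ) (i : Fin N) (x : E N) : ℝ :=
  (v u x)⁻¹ * partialD i u x

/-- The mean curvature `div (∇u / √(1 - |∇u|²))`. -/
def meanCurv (u : E N → ℝ) (x : E N) : ℝ :=
  ∑ i, partialD i (normalField u i) x

/-- The squared norm of the second fundamental form of the graph of `u`. -/
def secondFormSq (u : E N → ℝ) (x : E N) : ℝ :=
  ((∑ i, ∑ j, partialD2 i j u x ^ 2) + 2 * (∑ i, hessGrad u i x ^ 2) / v u x ^ 2
    + hessGradGrad u x ^ 2 / v u x ^ 4) / v u x ^ 2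

/-- The squared Lorentz distance along the graph of `u`. -/
def lorentzSq (u : E N → ℝ) (x₀ x : E N) : ℝ :=
  ‖x - x₀‖ ^ 2 - (u x - u x₀) ^ 2

/-- `v` times the Lorentz product of the position vector with the unit normal. -/
def supportFn (u : E N → ℝ) (x₀ x : E N) : ℝ :=
  (∑ j, partialD j u x * (x j - x₀ j)) - (u x - u x₀)

/-- `√det g` times the gradient on the graph of half the squared Lorentz distance. -/
def radialField (u : E N → ℝ) (x₀ : E N) (i : Fin N) (x : E N) : ℝ :=
  v u x * (x i - x₀ i) + supportFn u x₀ x * normalField u i x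

/-- A vector field whose divergence is `|A|² - H²`. -/
def curvField (u : E N → ℝ) (i : Fin N) (x : E N) : ℝ :=
  (∑ j, normalField u j x * partialD j (normalField u i) x) - normalField u i x * meanCurv u x

variable {u : E N → ℝ} {x₀ x : E N} (i j : Fin N)

lemma v_pos (hs : ‖gradient u x‖ < 1) : 0 < v u x := by
  apply Real.sqrt_pos.2
  nlinarith [norm_nonneg (gradient u x)]

lemma v_le_one : v u x ≤ 1 := by
  apply Real.sqrt_le_one.2
  nlinarith [sq_nonneg ‖gradient u x‖]

lemma v_sq (hs : ‖gradient u x‖ < 1) : v u x ^ 2 = 1 - ∑ i, partialD i u x ^ 2 := by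
  rw [v, Real.sq_sqrt (by nlinarith [norm_nonneg (gradient u x)]), norm_gradient_sq]

lemma contDiff_v (hu : ContDiff ℝ 3 u) (hs : ∀ x, ‖gradient u x‖ < 1) :
    ContDiff ℝ 2 (v u) := by
  unfold v
  refine ContDiff.sqrt ?_ fun x => ?_
  · simp_rw [norm_gradient_sq]
    refine contDiff_const.sub (ContDiff.sum fun i _ => ?_)
    exact (contDiff_partialD i hu (by norm_num)).pow 2
  · nlinarith [norm_nonneg (gradient u x), hs x]

lemma contDiff_normalField (hu : ContDiff ℝ 3 u) (hs : ∀ x, ‖gradient u x‖ < 1) :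
    ContDiff ℝ 2 (normalField u i) :=
  ((contDiff_v hu hs).inv fun x => (v_pos (hs x)).ne').mul
    (contDiff_partialD i hu (by norm_num))

lemma contDiff_meanCurv (hu : ContDiff ℝ 3 u) (hs : ∀ x, ‖gradient u x‖ < 1) :
    ContDiff ℝ 1 (meanCurv u) :=
  ContDiff.sum fun i _ => contDiff_partialD i (contDiff_normalField i hu hs) (by norm_num)

lemma contDiff_supportFn (hu : ContDiff ℝ 3 u) : ContDiff ℝ 2 (supportFn u x₀) := by
  refine (ContDiff.sum fun j _ => ?_).sub ((hu.of_le (by norm_num)).sub contDiff_const)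
  exact (contDiff_partialD j hu (by norm_num)).mul (contDiff_coord j x₀)

lemma contDiff_lorentzSq (hu : ContDiff ℝ 3 u) : ContDiff ℝ 3 (lorentzSq u x₀) :=
  ((contDiff_id.sub contDiff_const).norm_sq ℝ).sub ((hu.sub contDiff_const).pow 2)

lemma contDiff_radialField (hu : ContDiff ℝ 3 u) (hs : ∀ x, ‖gradient u x‖ < 1) :
    ContDiff ℝ 2 (radialField u x₀ i) :=
  ((contDiff_v hu hs).mul (contDiff_coord i x₀)).add
    ((contDiff_supportFn hu).mul (contDiff_normalField i hu hs))

lemma contDiff_curvField (hu : ContDiff ℝ 3 u) (hs : ∀ x, ‖gradient u x‖ < 1) :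
    ContDiff ℝ 1 (curvField u i) := by
  refine (ContDiff.sum fun j _ => ?_).sub ?_
  · exact ((contDiff_normalField j hu hs).of_le (by norm_num)).mul
      (contDiff_partialD j (contDiff_normalField i hu hs) (by norm_num))
  · exact ((contDiff_normalField i hu hs).of_le (by norm_num)).mul (contDiff_meanCurv hu hs)

lemma partialD2_comm (hu : ContDiff ℝ 3 u) : partialD2 i j u x = partialD2 j i u x :=
  partialD_comm i j (hu.of_le (by norm_num))

lemma partialD_v (hu : ContDiff ℝ 3 u) (hs : ∀ x, ‖gradient u x‖ < 1) :
    partialD i (v u) x = -hessGrad u i x / v u x := by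
  have hd : ∀ k, DifferentiableAt ℝ (partialD k u) x := fun k =>
    (contDiff_partialD (m := 2) k hu (by norm_num)).differentiable (by simp) x
  have h1 : partialD i (fun y => v u y * v u y) x = -2 * hessGrad u i x := by
    have : (fun y => v u y * v u y) = fun y => 1 - ∑ k, partialD k u y * partialD k u y := by
      ext y
      rw [← sq, v_sq (hs y)]
      simp [sq]
    rw [this, partialD_sub i (differentiableAt_const _)
      (DifferentiableAt.fun_sum fun k _ => (hd k).fun_mul (hd k)), partialD_const,
      partialD_sum i _ fun k _ => (hd k).fun_mul (hd k)]
    simp_rw [partialD_mul i (hd _) (hd _)]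
    rw [hessGrad, Finset.mul_sum, zero_sub, ← Finset.sum_neg_distrib]
    refine Finset.sum_congr rfl fun k _ => ?_
    rw [partialD2_comm i k hu, partialD2]
    ring
  have hv := v_pos (hs x)
  have hdv : DifferentiableAt ℝ (v u) x := (contDiff_v hu hs).differentiable (by simp) x
  rw [partialD_mul i hdv hdv] at h1
  field_simp
  linarith

lemma partialD_normalField (hu : ContDiff ℝ 3 u) (hs : ∀ x, ‖gradient u x‖ < 1) :
    partialD j (normalField u i) x =
      (v u x)⁻¹ * partialD2 i j u x + (v u x)⁻¹ ^ 3 * (partialD i u x * hessGrad u j x) := by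
  have hv := v_pos (hs x)
  have hdv : DifferentiableAt ℝ (v u) x := (contDiff_v hu hs).differentiable (by simp) x
  have hd : DifferentiableAt ℝ (partialD i u) x :=
    (contDiff_partialD (m := 2) i hu (by norm_num)).differentiable (by simp) x
  have h1 := partialD_comp j (hasDerivAt_inv hv.ne') hdv
  unfold normalField
  rw [partialD_mul j (hdv.fun_inv hv.ne') hd, h1, partialD_v j hu hs, partialD2]
  field_simp

lemma meanCurv_eq (hu : ContDiff ℝ 3 u) (hs : ∀ x, ‖gradient u x‖ < 1) :
    meanCurv u x = (v u x)⁻¹ * (∑ i, partialD2 i i u x) + (v u x)⁻¹ ^ 3 * hessGradGrad u x := by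
  simp_rw [meanCurv, partialD_normalField _ _ hu hs, hessGradGrad, Finset.sum_add_distrib,
    Finset.mul_sum]

lemma curvField_eq (hu : ContDiff ℝ 3 u) (hs : ∀ x, ‖gradient u x‖ < 1) :
    curvField u i x = (v u x)⁻¹ ^ 2 * hessGrad u i x
      + (v u x)⁻¹ ^ 4 * hessGradGrad u x * partialD i u x
      - (v u x)⁻¹ * meanCurv u x * partialD i u x := by
  simp_rw [curvField, partialD_normalField _ _ hu hs, normalField, hessGradGrad]
  rw [hessGrad, Finset.mul_sum, Finset.mul_sum, Finset.sum_mul, ← Finset.sum_add_distrib]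
  congr 1
  · refine Finset.sum_congr rfl fun k _ => ?_
    ring
  · ring

/-- The Jacobian of `∇u / v` is the shape operator in the coordinates of `ℝ^N`. Its matrix is not
symmetric there, so `|A|²` is the trace of its square and not the sum of its squared entries. -/
lemma secondFormSq_eq (hu : ContDiff ℝ 3 u) (hs : ∀ x, ‖gradient u x‖ < 1) :
    secondFormSq u x =
      ∑ i, ∑ j, partialD i (normalField u j) x * partialD j (normalField u i) x := by
  have hv := v_pos (hs x)
  have key : ∀ i j, partialD i (normalField u j) x * partialD j (normalField u i) x =
      (v u x)⁻¹ ^ 2 * partialD2 i j u x ^ 2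
      + (v u x)⁻¹ ^ 4 * (hessGrad u j x * (partialD2 j i u x * partialD i u x))
      + (v u x)⁻¹ ^ 4 * (hessGrad u i x * (partialD2 i j u x * partialD j u x))
      + (v u x)⁻¹ ^ 6 * ((partialD i u x * hessGrad u i x) * (partialD j u x * hessGrad u j x)) := by
    intro i j
    rw [partialD_normalField _ _ hu hs, partialD_normalField _ _ hu hs, partialD2_comm j i hu]
    ring
  have h1 : ∑ i, ∑ j, hessGrad u j x * (partialD2 j i u x * partialD i u x)
      = ∑ i, hessGrad u i x ^ 2 := by
    rw [Finset.sum_comm]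
    simp_rw [← Finset.mul_sum]
    refine Finset.sum_congr rfl fun k _ => ?_
    rw [sq]; rfl
  have h2 : ∑ i, ∑ j, hessGrad u i x * (partialD2 i j u x * partialD j u x)
      = ∑ i, hessGrad u i x ^ 2 := by
    simp_rw [← Finset.mul_sum]
    refine Finset.sum_congr rfl fun k _ => ?_
    rw [sq]; rfl
  have h3 : ∑ i, ∑ j, (partialD i u x * hessGrad u i x) * (partialD j u x * hessGrad u j x)
      = hessGradGrad u x ^ 2 := by
    simp_rw [← Finset.mul_sum, ← Finset.sum_mul]
    rw [sq]; rfl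
  simp_rw [key, Finset.sum_add_distrib, ← Finset.mul_sum]
  simp_rw [← Finset.mul_sum] at h1 h2 h3
  rw [h1, h2, h3, secondFormSq]
  field_simp
  ring

/-- For any `C²` field `X`, `div((X·∇)X - X div X) = tr((DX)²) - (div X)²`: the second derivatives
of `X` cancel because partial derivatives commute. Hence `|A|²` enters the integral identity without
any derivative of the mean curvature. -/
lemma sum_partialD_curvField (hu : ContDiff ℝ 3 u) (hs : ∀ x, ‖gradient u x‖ < 1) :
    ∑ i, partialD i (curvField u i) x = secondFormSq u x - meanCurv u x ^ 2 := by
  have hF := fun k => contDiff_normalField (u := u) k hu hs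
  have hF1 : ∀ k, DifferentiableAt ℝ (normalField u k) x := fun k =>
    (hF k).differentiable (by simp) x
  have hF2 : ∀ k l, DifferentiableAt ℝ (partialD l (normalField u k)) x := fun k l =>
    (contDiff_partialD (m := 1) l (hF k) (by norm_num)).differentiable (by simp) x
  have hH : DifferentiableAt ℝ (meanCurv u) x :=
    (contDiff_meanCurv hu hs).differentiable (by simp) x
  have key : ∀ i, partialD i (curvField u i) x =
      (∑ j, (normalField u j x * partialD j (partialD i (normalField u i)) x
        + partialD i (normalField u j) x * partialD j (normalField u i) x))
      - (normalField u i x * partialD i (meanCurv u) x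
        + meanCurv u x * partialD i (normalField u i) x) := by
    intro i
    unfold curvField
    rw [partialD_sub i (DifferentiableAt.fun_sum fun k _ => (hF1 k).fun_mul (hF2 i k))
      ((hF1 i).fun_mul hH), partialD_sum i _ fun k _ => (hF1 k).fun_mul (hF2 i k),
      partialD_mul i (hF1 i) hH]
    congr 1
    refine Finset.sum_congr rfl fun j _ => ?_
    rw [partialD_mul i (hF1 j) (hF2 i j), partialD_comm j i (hF i)]
    ring
  have hHd : ∀ j, partialD j (meanCurv u) x = ∑ i, partialD j (partialD i (normalField u i)) x := by
    intro j
    unfold meanCurv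
    exact partialD_sum j _ fun k _ => hF2 k k
  simp_rw [key, Finset.sum_sub_distrib, Finset.sum_add_distrib, hHd, secondFormSq_eq hu hs]
  rw [Finset.sum_comm]
  simp_rw [Finset.mul_sum, ← Finset.mul_sum]
  have : ∑ i, partialD i (normalField u i) x = meanCurv u x := rfl
  rw [this]
  ring

lemma norm_sub_sq_eq_sum : ‖x - x₀‖ ^ 2 = ∑ j, (x j - x₀ j) ^ 2 := by
  rw [EuclideanSpace.norm_sq_eq]
  simp

lemma partialD_supportFn (hu : ContDiff ℝ 3 u) :
    partialD i (supportFn u x₀) x = ∑ j, partialD2 i j u x * (x j - x₀ j) := by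
  have hd : ∀ k, DifferentiableAt ℝ (partialD k u) x := fun k =>
    (contDiff_partialD (m := 2) k hu (by norm_num)).differentiable (by simp) x
  have hc : ∀ k, DifferentiableAt ℝ (fun y : E N => y k - x₀ k) x := fun k =>
    (contDiff_coord (n := 1) k x₀).differentiable (by simp) x
  have hdu : DifferentiableAt ℝ u x := hu.differentiable (by simp) x
  unfold supportFn
  rw [partialD_sub i (DifferentiableAt.fun_sum fun k _ => (hd k).fun_mul (hc k))
    (hdu.fun_sub (differentiableAt_const _)), partialD_sum i _ fun k _ => (hd k).fun_mul (hc k),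
    partialD_sub i hdu (differentiableAt_const _), partialD_const]
  simp_rw [partialD_mul i (hd _) (hc _), partialD_coord, Finset.sum_add_distrib, mul_ite, mul_one,
    mul_zero]
  simp only [Finset.sum_ite_eq, Finset.mem_univ, if_true, sub_zero, add_sub_cancel_left]
  refine Finset.sum_congr rfl fun k _ => ?_
  rw [partialD2_comm i k hu, partialD2]
  ring

lemma partialD_lorentzSq (hu : ContDiff ℝ 3 u) :
    partialD i (lorentzSq u x₀) x =
      2 * ((x i - x₀ i) - (u x - u x₀) * partialD i u x) := by
  have hc : ∀ k, DifferentiableAt ℝ (fun y : E N => y k - x₀ k) x := fun k =>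
    (contDiff_coord (n := 1) k x₀).differentiable (by simp) x
  have hdu : DifferentiableAt ℝ (fun y => u y - u x₀) x :=
    (hu.differentiable (by simp) x).sub (differentiableAt_const _)
  have h0 : lorentzSq u x₀ = fun y => (∑ k, (y k - x₀ k) * (y k - x₀ k))
      - (u y - u x₀) * (u y - u x₀) := by
    ext y
    rw [lorentzSq, norm_sub_sq_eq_sum]
    simp [sq]
  rw [h0, partialD_sub i (DifferentiableAt.fun_sum fun k _ => (hc k).fun_mul (hc k)) (hdu.fun_mul hdu),
    partialD_sum i _ fun k _ => (hc k).fun_mul (hc k), partialD_mul i hdu hdu,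
    partialD_sub i (hu.differentiable (by simp) x) (differentiableAt_const _), partialD_const]
  simp_rw [partialD_mul i (hc _) (hc _), partialD_coord, Finset.sum_add_distrib, mul_ite, mul_one,
    mul_zero]
  simp only [Finset.sum_ite_eq, Finset.mem_univ, if_true, sub_zero]
  ring

/-- The terms in `D²u` cancel by symmetry of the Hessian. Divided by `v`, this is the formula `N + H
P` for the Laplacian on the graph of half the squared Lorentz distance. -/
lemma sum_partialD_radialField (hu : ContDiff ℝ 3 u) (hs : ∀ x, ‖gradient u x‖ < 1) :
    ∑ i, partialD i (radialField u x₀ i) x = N * v u x + supportFn u x₀ x * meanCurv u x := by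
  have hv := v_pos (hs x)
  have hdv : DifferentiableAt ℝ (v u) x := (contDiff_v hu hs).differentiable (by simp) x
  have hc : ∀ k, DifferentiableAt ℝ (fun y : E N => y k - x₀ k) x := fun k =>
    (contDiff_coord (n := 1) k x₀).differentiable (by simp) x
  have hF1 : ∀ k, DifferentiableAt ℝ (normalField u k) x := fun k =>
    (contDiff_normalField (u := u) k hu hs).differentiable (by simp) x
  have hQ : DifferentiableAt ℝ (supportFn u x₀) x :=
    (contDiff_supportFn hu).differentiable (by simp) x
  have key : ∀ i, partialD i (radialField u x₀ i) x = v u x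
      - (v u x)⁻¹ * (∑ j, (x i - x₀ i) * (partialD2 i j u x * partialD j u x))
      + (v u x)⁻¹ * (∑ j, (x j - x₀ j) * (partialD2 j i u x * partialD i u x))
      + supportFn u x₀ x * partialD i (normalField u i) x := by
    intro i
    unfold radialField
    rw [partialD_add i (hdv.fun_mul (hc i)) (hQ.fun_mul (hF1 i)), partialD_mul i hdv (hc i),
      partialD_mul i hQ (hF1 i), partialD_coord, partialD_v i hu hs, partialD_supportFn i hu,
      ← Finset.mul_sum, normalField, if_pos rfl, hessGrad]
    have : ∑ j, (x j - x₀ j) * (partialD2 j i u x * partialD i u x)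
        = partialD i u x * ∑ j, partialD2 i j u x * (x j - x₀ j) := by
      rw [Finset.mul_sum]
      refine Finset.sum_congr rfl fun k _ => ?_
      rw [partialD2_comm i k hu]
      ring
    rw [this]
    field_simp
    ring
  simp_rw [key, Finset.sum_add_distrib, Finset.sum_sub_distrib, ← Finset.mul_sum]
  have := Finset.sum_comm (s := (Finset.univ : Finset (Fin N))) (t := Finset.univ)
    (f := fun j i => (x j - x₀ j) * (partialD2 j i u x * partialD i u x))
  simp_rw [← Finset.mul_sum] at this
  rw [← this, meanCurv]
  simp

end Geometry

/-! ### The weighted integral identity -/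

section DivergenceIdentity

variable {u : E N → ℝ} {x₀ x : E N} (i j : Fin N)

lemma sum_partialD_mul_coord :
    ∑ i, partialD i u x * (x i - x₀ i) = supportFn u x₀ x + (u x - u x₀) := by
  simp [supportFn]

lemma sum_partialD_sq (hs : ‖gradient u x‖ < 1) : ∑ i, partialD i u x ^ 2 = 1 - v u x ^ 2 := by
  rw [v_sq hs]; ring

/-- The unit normal is timelike, so the tangential part of the position vector has squared length
`l² + P²`, more than `l²`. The surplus `P²` later absorbs the term `H P`. -/
lemma sum_lorentzSq_radialField (hu : ContDiff ℝ 3 u) (hs : ∀ x, ‖gradient u x‖ < 1) :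
    ∑ i, partialD i (lorentzSq u x₀) x * radialField u x₀ i x =
      2 * (v u x * lorentzSq u x₀ x + supportFn u x₀ x ^ 2 / v u x) := by
  have hv := v_pos (hs x)
  have key : ∀ i, partialD i (lorentzSq u x₀) x * radialField u x₀ i x =
      2 * v u x * (x i - x₀ i) ^ 2
      + 2 * (supportFn u x₀ x / v u x - v u x * (u x - u x₀)) * (partialD i u x * (x i - x₀ i))
      - 2 * ((u x - u x₀) * supportFn u x₀ x / v u x) * partialD i u x ^ 2 := by
    intro i
    rw [partialD_lorentzSq i hu, radialField, normalField]
    field_simp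
    ring
  simp_rw [key, Finset.sum_sub_distrib, Finset.sum_add_distrib, ← Finset.mul_sum]
  rw [sum_partialD_mul_coord, sum_partialD_sq (hs x), lorentzSq, norm_sub_sq_eq_sum]
  field_simp
  ring

lemma sum_v_radialField (hu : ContDiff ℝ 3 u) (hs : ∀ x, ‖gradient u x‖ < 1) :
    ∑ i, partialD i (v u) x * radialField u x₀ i x =
      -((∑ i, hessGrad u i x * (x i - x₀ i)) + supportFn u x₀ x * hessGradGrad u x / v u x ^ 2) := by
  have hv := v_pos (hs x)
  have key : ∀ i, partialD i (v u) x * radialField u x₀ i x =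
      (-1) * (hessGrad u i x * (x i - x₀ i))
      + (-(supportFn u x₀ x / v u x ^ 2)) * (partialD i u x * hessGrad u i x) := by
    intro i
    rw [partialD_v i hu hs, radialField, normalField]
    field_simp
    ring
  simp_rw [key, Finset.sum_add_distrib, ← Finset.mul_sum]
  rw [← hessGradGrad]
  ring

lemma sum_lorentzSq_curvField (hu : ContDiff ℝ 3 u) (hs : ∀ x, ‖gradient u x‖ < 1) :
    ∑ i, partialD i (lorentzSq u x₀) x * curvField u i x =
      2 * (((∑ i, hessGrad u i x * (x i - x₀ i)) - (u x - u x₀) * hessGradGrad u x) / v u x ^ 2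
        + (hessGradGrad u x / v u x ^ 4 - meanCurv u x / v u x) *
          (supportFn u x₀ x + (u x - u x₀) * v u x ^ 2)) := by
  have hv := v_pos (hs x)
  have key : ∀ i, partialD i (lorentzSq u x₀) x * curvField u i x =
      2 / v u x ^ 2 * (hessGrad u i x * (x i - x₀ i))
      + (-(2 / v u x ^ 2 * (u x - u x₀))) * (partialD i u x * hessGrad u i x)
      + 2 * (hessGradGrad u x / v u x ^ 4 - meanCurv u x / v u x) *
        (partialD i u x * (x i - x₀ i))
      - 2 * (hessGradGrad u x / v u x ^ 4 - meanCurv u x / v u x) * (u x - u x₀) *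
        partialD i u x ^ 2 := by
    intro i
    rw [partialD_lorentzSq i hu, curvField_eq i hu hs]
    field_simp
    ring
  simp_rw [key, Finset.sum_sub_distrib, Finset.sum_add_distrib, ← Finset.mul_sum]
  rw [sum_partialD_mul_coord, sum_partialD_sq (hs x), ← hessGradGrad]
  ring

lemma sum_v_curvField (hu : ContDiff ℝ 3 u) (hs : ∀ x, ‖gradient u x‖ < 1) :
    ∑ i, partialD i (v u) x * curvField u i x =
      -(((∑ i, hessGrad u i x ^ 2) + hessGradGrad u x ^ 2 / v u x ^ 2
        - meanCurv u x * hessGradGrad u x * v u x) / v u x ^ 3) := by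
  have hv := v_pos (hs x)
  have key : ∀ i, partialD i (v u) x * curvField u i x =
      (-(1 / v u x ^ 3)) * hessGrad u i x ^ 2
      + (-(hessGradGrad u x / v u x ^ 5 - meanCurv u x / v u x ^ 2)) *
        (partialD i u x * hessGrad u i x) := by
    intro i
    rw [partialD_v i hu hs, curvField_eq i hu hs]
    field_simp
    ring
  simp_rw [key, Finset.sum_add_distrib, ← Finset.mul_sum]
  rw [← hessGradGrad]
  field_simp
  ring

/-- The Lorentz product of the position vector with the unit normal of the graph. -/
def normalPart (u : E N → ℝ) (x₀ x : E N) : ℝ := supportFn u x₀ x / v u x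

/-- The factor of the first order test function in the integral identity. -/
def coeffFirst (γ : ℝ) (u : E N → ℝ) (x₀ x : E N) : ℝ :=
  v u x ^ (γ + 1) * (N + meanCurv u x * normalPart u x₀ x
    - γ * (meanCurv u x * (normalPart u x₀ x + (u x - u x₀) * v u x)))

/-- The factor of the derivative of the first order test function in the integral identity. -/
def coeffDeriv (γ : ℝ) (u : E N → ℝ) (x₀ x : E N) : ℝ :=
  2 * v u x ^ (γ + 1) * (lorentzSq u x₀ x + normalPart u x₀ x ^ 2)

/-- The factor of the second order test function in the integral identity. -/
def coeffSecond (γ : ℝ) (u : E N → ℝ) (x : E N) : ℝ :=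
  γ * v u x ^ (γ + 1) * (-secondFormSq u x + meanCurv u x ^ 2
    + (γ + 1) * ((∑ i, hessGrad u i x ^ 2) + hessGradGrad u x ^ 2 / v u x ^ 2
      - meanCurv u x * hessGradGrad u x * v u x) / v u x ^ 4)

/-- The test field of the integral identity. -/
def testField (γ : ℝ) (u : E N → ℝ) (x₀ : E N) (φ Ψ : ℝ → ℝ) (i : Fin N) (x : E N) : ℝ :=
  φ (lorentzSq u x₀ x) * (v u x ^ γ * radialField u x₀ i x)
    - γ * (Ψ (lorentzSq u x₀ x) * (v u x ^ (γ + 1) * curvField u i x))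

lemma contDiff_v_rpow (hu : ContDiff ℝ 3 u) (hs : ∀ x, ‖gradient u x‖ < 1) (α : ℝ) :
    ContDiff ℝ 2 (fun x => v u x ^ α) :=
  (contDiff_v hu hs).rpow_const_of_ne fun x => (v_pos (hs x)).ne'

lemma partialD_v_rpow (hu : ContDiff ℝ 3 u) (hs : ∀ x, ‖gradient u x‖ < 1) (α : ℝ) :
    partialD i (fun x => v u x ^ α) x = α * v u x ^ (α - 1) * partialD i (v u) x :=
  partialD_comp i (Real.hasDerivAt_rpow_const (Or.inl (v_pos (hs x)).ne'))
    ((contDiff_v hu hs).differentiable (by simp) x)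

/-- The derivative of `v^γ` along `radialField` and the derivative of `Ψ` along `curvField` both
contain `⟨D²u ∇u, x - x₀⟩`, a term without a sign; `Ψ' = -φ/2` and the weight `v^(γ+1)` make these
two contributions cancel. What survives of the first-order part is the small drift `-γ H (P + (u -
u(x₀)) v)` in `coeffFirst`. -/
lemma sum_partialD_testField (hu : ContDiff ℝ 3 u) (hs : ∀ x, ‖gradient u x‖ < 1)
    {γ : ℝ} {φ Ψ χ : ℝ → ℝ} (hφ : ∀ t, HasDerivAt φ (-χ t) t)
    (hΨ : ∀ t, HasDerivAt Ψ (-(φ t / 2)) t) :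
    ∑ i, partialD i (testField γ u x₀ φ Ψ i) x =
      φ (lorentzSq u x₀ x) * coeffFirst γ u x₀ x - χ (lorentzSq u x₀ x) * coeffDeriv γ u x₀ x
        + Ψ (lorentzSq u x₀ x) * coeffSecond γ u x := by
  have hv := v_pos (hs x)
  have hL : DifferentiableAt ℝ (lorentzSq u x₀) x :=
    (contDiff_lorentzSq hu).differentiable (by simp) x
  have hφL : DifferentiableAt ℝ (fun y => φ (lorentzSq u x₀ y)) x :=
    (hφ _).differentiableAt.fun_comp' x hL
  have hΨL : DifferentiableAt ℝ (fun y => Ψ (lorentzSq u x₀ y)) x :=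
    (hΨ _).differentiableAt.fun_comp' x hL
  have hvp : ∀ α : ℝ, DifferentiableAt ℝ (fun y => v u y ^ α) x := fun α =>
    (contDiff_v_rpow hu hs α).differentiable (by simp) x
  have hV : ∀ k, DifferentiableAt ℝ (radialField u x₀ k) x := fun k =>
    (contDiff_radialField k hu hs).differentiable (by simp) x
  have hW : ∀ k, DifferentiableAt ℝ (curvField u k) x := fun k =>
    (contDiff_curvField k hu hs).differentiable (by simp) x
  set G := v u x ^ γ with hG
  have hG1 : v u x ^ (γ + 1) = G * v u x := Real.rpow_add_one hv.ne' γ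
  have hG2 : v u x ^ (γ - 1) = G / v u x := Real.rpow_sub_one hv.ne' γ
  set F := φ (lorentzSq u x₀ x) with hF
  set P := Ψ (lorentzSq u x₀ x) with hP
  set X := χ (lorentzSq u x₀ x) with hX
  have key : ∀ i, partialD i (testField γ u x₀ φ Ψ i) x =
      (-(X * G)) * (partialD i (lorentzSq u x₀) x * radialField u x₀ i x)
      + (F * γ * G / v u x) * (partialD i (v u) x * radialField u x₀ i x)
      + (F * G) * partialD i (radialField u x₀ i) x
      + (γ * F / 2 * G * v u x) * (partialD i (lorentzSq u x₀) x * curvField u i x)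
      + (-(γ * P * (γ + 1) * G)) * (partialD i (v u) x * curvField u i x)
      + (-(γ * P * G * v u x)) * partialD i (curvField u i) x := by
    intro i
    unfold testField
    rw [partialD_sub i (hφL.fun_mul ((hvp γ).fun_mul (hV i)))
      ((differentiableAt_const γ).fun_mul (hΨL.fun_mul ((hvp (γ + 1)).fun_mul (hW i)))),
      partialD_mul i hφL ((hvp γ).fun_mul (hV i)),
      partialD_mul i (differentiableAt_const γ) (hΨL.fun_mul ((hvp (γ + 1)).fun_mul (hW i))),
      partialD_mul i hΨL ((hvp (γ + 1)).fun_mul (hW i)), partialD_mul i (hvp γ) (hV i),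
      partialD_mul i (hvp (γ + 1)) (hW i), partialD_const, partialD_v_rpow i hu hs,
      partialD_v_rpow i hu hs, partialD_comp i (hφ _) hL, partialD_comp i (hΨ _) hL,
      add_sub_cancel_right, hG1, hG2, ← hF, ← hP, ← hX, ← hG]
    ring
  simp_rw [key, Finset.sum_add_distrib, ← Finset.mul_sum]
  rw [sum_lorentzSq_radialField hu hs, sum_v_radialField hu hs, sum_partialD_radialField hu hs,
    sum_lorentzSq_curvField hu hs, sum_v_curvField hu hs, sum_partialD_curvField hu hs,
    coeffFirst, coeffDeriv, coeffSecond, normalPart, hG1]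
  -- The rest is an algebraic identity in these quantities, now treated as independent variables.
  generalize secondFormSq u x = A
  generalize meanCurv u x = H
  generalize hessGradGrad u x = μ
  generalize supportFn u x₀ x = Q
  generalize ∑ i, hessGrad u i x ^ 2 = n
  generalize ∑ i, hessGrad u i x * (x i - x₀ i) = m
  field_simp
  ring

lemma integral_test_eq_zero (hu : ContDiff ℝ 3 u) (hs : ∀ x, ‖gradient u x‖ < 1)
    {γ r : ℝ} {φ Ψ χ : ℝ → ℝ} (hχ : Continuous χ) (hφ : ∀ t, HasDerivAt φ (-χ t) t)
    (hΨ : ∀ t, HasDerivAt Ψ (-(φ t / 2)) t) (hφr : ∀ t, r ≤ t → φ t = 0)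
    (hΨr : ∀ t, r ≤ t → Ψ t = 0) (hK : IsCompact {x | lorentzSq u x₀ x ≤ r}) :
    ∫ x, (φ (lorentzSq u x₀ x) * coeffFirst γ u x₀ x
      - χ (lorentzSq u x₀ x) * coeffDeriv γ u x₀ x
      + Ψ (lorentzSq u x₀ x) * coeffSecond γ u x) = 0 := by
  have hφ1 : ContDiff ℝ 1 φ := by
    rw [contDiff_one_iff_deriv]
    refine ⟨fun t => (hφ t).differentiableAt, ?_⟩
    rw [show deriv φ = fun t => -χ t from funext fun t => (hφ t).deriv]
    exact hχ.neg
  have hΨ1 : ContDiff ℝ 1 Ψ := by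
    rw [contDiff_one_iff_deriv]
    refine ⟨fun t => (hΨ t).differentiableAt, ?_⟩
    rw [show deriv Ψ = fun t => -(φ t / 2) from funext fun t => (hΨ t).deriv]
    exact (hφ1.continuous.div_const 2).neg
  have hL : ContDiff ℝ 1 (lorentzSq u x₀) := (contDiff_lorentzSq hu).of_le (by norm_num)
  simp_rw [← sum_partialD_testField hu hs hφ hΨ]
  refine integral_sum_partialD_eq_zero (fun i => ?_) fun i => ?_
  · refine ((hφ1.comp hL).mul (((contDiff_v_rpow hu hs γ).of_le (by norm_num)).mul
      ((contDiff_radialField i hu hs).of_le (by norm_num)))).sub ?_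
    exact contDiff_const.mul ((hΨ1.comp hL).mul
      (((contDiff_v_rpow hu hs (γ + 1)).of_le (by norm_num)).mul (contDiff_curvField i hu hs)))
  · refine HasCompactSupport.intro hK fun x hx => ?_
    have hx' : r ≤ lorentzSq u x₀ x := (not_le.1 hx).le
    simp [testField, hφr _ hx', hΨr _ hx']

end DivergenceIdentity

/-! ### Pointwise inequalities for the curvature terms -/

section PointwiseEstimates

/-- Compressing `s` to the hyperplane orthogonal to `e` gives the matrix `b`, of trace `tr s - a`
and squared norm `|s|² - 2|m|² + a²`. Cauchy-Schwarz on the diagonal of `b` bounds its norm below by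
its trace; the factor `1/N`, in place of the sharp `1/(N-1)`, suffices. -/
lemma sum_sq_ge_of_unit (s : Fin N → Fin N → ℝ) (hsym : ∀ i j, s i j = s j i) (e m : Fin N → ℝ)
    (hm : ∀ i, m i = ∑ j, s i j * e j) (he : ∑ i, e i ^ 2 = 1) {a : ℝ}
    (ha : a = ∑ i, e i * m i) :
    2 * (∑ i, m i ^ 2) - a ^ 2 + ((∑ i, s i i) - a) ^ 2 / N ≤ ∑ i, ∑ j, s i j ^ 2 := by
  set b : Fin N → Fin N → ℝ := fun i j => s i j - e i * m j - m i * e j + a * (e i * e j) with hb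
  have h1 : ∑ i, ∑ j, b i j ^ 2 = (∑ i, ∑ j, s i j ^ 2) - 2 * (∑ i, m i ^ 2) + a ^ 2 := by
    have key : ∀ i j, b i j ^ 2 = s i j ^ 2 + e i ^ 2 * m j ^ 2 + m i ^ 2 * e j ^ 2
        + a ^ 2 * (e i ^ 2 * e j ^ 2) - 2 * (m j * (s j i * e i)) - 2 * (m i * (s i j * e j))
        + 2 * a * (e i * (s i j * e j)) + 2 * ((e i * m i) * (e j * m j))
        - 2 * a * (e i ^ 2 * (e j * m j)) - 2 * a * ((e i * m i) * e j ^ 2) := by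
      intro i j
      rw [hb, hsym j i]
      ring
    have h2 : ∑ i, ∑ j, m j * (s j i * e i) = ∑ i, m i ^ 2 := by
      rw [Finset.sum_comm]
      simp_rw [← Finset.mul_sum, ← hm, sq]
    simp only [key, Finset.sum_add_distrib, Finset.sum_sub_distrib, ← Finset.mul_sum]
    simp only [h2, ← hm, ← Finset.sum_mul, he, ← ha, ← sq]
    ring
  have h3 : ∑ i, b i i = (∑ i, s i i) - a := by
    have key : ∀ i, b i i = s i i - 2 * (e i * m i) + a * e i ^ 2 := by
      intro i; rw [hb]; ring
    simp_rw [key, Finset.sum_add_distrib, Finset.sum_sub_distrib, ← Finset.mul_sum]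
    rw [← ha, he]
    ring
  have h4 : ∑ i, b i i ^ 2 ≤ ∑ i, ∑ j, b i j ^ 2 :=
    Finset.sum_le_sum fun i _ =>
      Finset.single_le_sum (f := fun j => b i j ^ 2) (fun j _ => sq_nonneg _) (Finset.mem_univ i)
  have h5 : (∑ i, b i i) ^ 2 ≤ N * ∑ i, b i i ^ 2 := by
    simpa using sq_sum_le_card_mul_sum_sq (s := (Finset.univ : Finset (Fin N)))
      (f := fun i => b i i)
  rw [h3] at h5
  have h6 : ((∑ i, s i i) - a) ^ 2 / N ≤ ∑ i, b i i ^ 2 := by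
    rcases Nat.eq_zero_or_pos N with h0 | h0
    · subst h0; simp
    · rw [div_le_iff₀ (by positivity)]
      linarith
  linarith

variable {u : E N → ℝ} {x₀ x : E N}

lemma secondFormSq_nonneg : 0 ≤ secondFormSq u x := by
  unfold secondFormSq
  positivity

lemma sum_sq_le_secondFormSq (hs : ‖gradient u x‖ < 1) :
    (∑ i, ∑ j, partialD2 i j u x ^ 2) / v u x ^ 2 ≤ secondFormSq u x := by
  have hv := v_pos hs
  unfold secondFormSq
  gcongr
  have h1 : 0 ≤ 2 * (∑ i, hessGrad u i x ^ 2) / v u x ^ 2 := by positivity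
  have h2 : 0 ≤ hessGradGrad u x ^ 2 / v u x ^ 4 := by positivity
  linarith

/-- Since `v ≤ 1` and `γ + 1 ≤ 2`, the weight `v^(γ+1)` is at least `v²`, which compensates the
factor `v^(-2)` in front of the Hessian in `|A|²`. This is why the final Hessian integral carries no
weight. -/
lemma sum_sq_le_rpow_mul_secondFormSq (hs : ‖gradient u x‖ < 1) {γ : ℝ} (hγ : γ ≤ 1) :
    ∑ i, ∑ j, partialD2 i j u x ^ 2 ≤ v u x ^ (γ + 1) * secondFormSq u x := by
  have hv := v_pos hs
  have h1 : v u x ^ (2 : ℝ) ≤ v u x ^ (γ + 1) :=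
    Real.rpow_le_rpow_of_exponent_ge hv v_le_one (by linarith)
  rw [Real.rpow_two] at h1
  have h2 := sum_sq_le_secondFormSq hs
  rw [div_le_iff₀ (by positivity)] at h2
  nlinarith [secondFormSq_nonneg (u := u) (x := x)]

/-- Keep `γ A` and spend `(1 - γ) A` on the gradient term. The coefficient 2 of `b` beats `1 + γ`.
For `a`, the trace part `(H - a)²/n` gives the extra room: `a` is large only if `H` is large or `H -
a` is, up to a multiple of `H²`. -/
lemma quadratic_bound {n γ t a b H A : ℝ} (hn : 1 ≤ n) (hγ : 0 ≤ γ) (hγn : 16 * n * γ ≤ 1)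
    (ht0 : 0 ≤ t) (ht1 : t ≤ 1) (hb : 0 ≤ b) (hA : a ^ 2 + 2 * b + (H - a) ^ 2 / n ≤ A) :
    -A + H ^ 2 + (γ + 1) * t * (a ^ 2 + b - H * a) ≤ -γ * A + (2 * n + 1) * H ^ 2 := by
  have hγ1 : γ ≤ 1 / 16 := by nlinarith
  have h1 : (1 - γ) * (a ^ 2 + 2 * b + (H - a) ^ 2 / n) ≤ (1 - γ) * A :=
    mul_le_mul_of_nonneg_left hA (by linarith)
  have h2 : (γ + 1) * t * b ≤ (1 - γ) * (2 * b) := by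
    have : (γ + 1) * t ≤ 2 * (1 - γ) := by nlinarith
    nlinarith
  have hdn : 0 ≤ (H - a) ^ 2 / n := by positivity
  suffices h : (γ + 1) * t * (a ^ 2 - H * a) ≤
      (1 - γ) * (a ^ 2 + (H - a) ^ 2 / n) + 2 * n * H ^ 2 by nlinarith
  -- The factor `t ∈ [0, 1]` is harmless for either sign: a nonpositive term is dropped, and for a
  -- nonnegative one `t` is replaced by 1.
  rcases le_total (a ^ 2 - H * a) 0 with h | h
  · have h3 : (γ + 1) * t * (a ^ 2 - H * a) ≤ 0 := mul_nonpos_of_nonneg_of_nonpos (by positivity) h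
    have h4 : 0 ≤ (1 - γ) * (a ^ 2 + (H - a) ^ 2 / n) := mul_nonneg (by linarith) (by positivity)
    nlinarith [sq_nonneg H]
  · have h3 : (γ + 1) * t * (a ^ 2 - H * a) ≤ (γ + 1) * (a ^ 2 - H * a) := by
      have : (γ + 1) * t ≤ γ + 1 := by nlinarith
      nlinarith
    obtain ⟨d, rfl⟩ : ∃ d, a = H + d := ⟨a - H, by ring⟩
    have e1 : (H - (H + d)) ^ 2 / n = d ^ 2 / n := by ring
    rw [e1]
    have h5 : γ * n ≤ 1 / 16 := by nlinarith
    -- With `a = H + d` the excess is `2γd² + (3γ - 1)Hd - (1 - γ)H²`. Its first two terms use `1/8`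
    -- and `3/4` of `d²/n`, within the available `1 - γ ≥ 15/16`; the condition `16 n γ ≤ 1` is what
    -- allows the `1/8`.
    have h6 : 2 * γ * d ^ 2 ≤ (1 / 8) * (d ^ 2 / n) := by
      rw [← mul_div_assoc, le_div_iff₀ (by linarith)]
      nlinarith [sq_nonneg d]
    have h7 : (3 * γ - 1) * (H * d) ≤ (3 / 4) * (d ^ 2 / n) + 2 * n * H ^ 2 := by
      have h8 : |3 * γ - 1| ≤ 1 := by rw [abs_le]; constructor <;> linarith
      have h9 : (3 * γ - 1) * (H * d) ≤ |H * d| := by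
        calc _ ≤ |(3 * γ - 1) * (H * d)| := le_abs_self _
          _ = |3 * γ - 1| * |H * d| := abs_mul _ _
          _ ≤ 1 * |H * d| := by gcongr
          _ = _ := one_mul _
      have h10 : |H * d| ≤ (3 / 4) * (d ^ 2 / n) + 2 * n * H ^ 2 := by
        have hq : (3 / 4) * (d ^ 2 / n) + 2 * n * H ^ 2 - |H| * |d| =
            ((3 / 4) * |d| ^ 2 - |H| * |d| * n + 2 * n ^ 2 * |H| ^ 2) / n := by
          rw [sq_abs, sq_abs]
          field_simp
          ring
        have hq2 : 0 ≤ (3 / 4) * |d| ^ 2 - |H| * |d| * n + 2 * n ^ 2 * |H| ^ 2 := by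
          nlinarith [sq_nonneg (|d| - n * |H|), sq_nonneg (n * |H|), sq_nonneg |d|]
        rw [abs_mul]
        have := div_nonneg hq2 (by linarith : 0 ≤ n)
        linarith
      linarith
    have h11 : 0 ≤ d ^ 2 / n := by positivity
    nlinarith [sq_nonneg H]

/-- In an orthonormal frame of the graph adapted to `∇u`, let `a` be the normal curvature along `∇u`
and `b` the squared length of the mixed entries of the second fundamental form. The gradient term in
`coeffSecond` is then `(γ + 1) t (a² + b - H a)` with `t = |∇u|²`, and `quadratic_bound` applies. -/
lemma coeffSecond_le (hu : ContDiff ℝ 3 u) (hs : ∀ x, ‖gradient u x‖ < 1) (hN : 1 ≤ N) {γ : ℝ}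
    (hγ : 0 ≤ γ) (hγN : 16 * N * γ ≤ 1) :
    coeffSecond γ u x ≤ γ * v u x ^ (γ + 1) *
      (-γ * secondFormSq u x + (2 * N + 1) * meanCurv u x ^ 2) := by
  have hv := v_pos (hs x)
  unfold coeffSecond
  refine mul_le_mul_of_nonneg_left ?_ (mul_nonneg hγ (Real.rpow_nonneg hv.le _))
  have hN' : (1 : ℝ) ≤ N := by exact_mod_cast hN
  set t := ∑ i, partialD i u x ^ 2 with ht
  have ht0 : 0 ≤ t := by positivity
  have hvt : v u x ^ 2 = 1 - t := v_sq (hs x)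
  have ht1 : t ≤ 1 := by nlinarith [sq_nonneg (v u x)]
  have hCS : hessGradGrad u x ^ 2 ≤ t * ∑ i, hessGrad u i x ^ 2 :=
    Finset.sum_mul_sq_le_sq_mul_sq _ _ _
  -- Where `∇u = 0` there is no direction `∇u/|∇u|`, but the gradient term vanishes too.
  rcases ht0.eq_or_lt with h0 | h0
  · have hp : ∀ i, partialD i u x = 0 := by
      intro i
      have := (Finset.sum_eq_zero_iff_of_nonneg fun i _ => sq_nonneg (partialD i u x)).1
        (ht ▸ h0.symm) i (Finset.mem_univ i)
      exact pow_eq_zero_iff (two_ne_zero) |>.1 this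
    have hm : ∀ i, hessGrad u i x = 0 := by
      intro i; simp [hessGrad, hp]
    have hμ : hessGradGrad u x = 0 := by simp [hessGradGrad, hp]
    simp only [hm, hμ]
    have := secondFormSq_nonneg (u := u) (x := x)
    have hγ1 : γ ≤ 1 := by nlinarith
    norm_num
    nlinarith [sq_nonneg (meanCurv u x)]
  · set μ := hessGradGrad u x with hμ
    set n := ∑ i, hessGrad u i x ^ 2 with hn
    set w := v u x with hw
    have hr : 0 < Real.sqrt t := Real.sqrt_pos.2 h0
    have hr2 : Real.sqrt t ^ 2 = t := Real.sq_sqrt ht0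
    have h1 := sum_sq_ge_of_unit (fun i j => partialD2 i j u x)
      (fun i j => partialD2_comm i j hu) (fun i => partialD i u x / Real.sqrt t)
      (fun i => hessGrad u i x / Real.sqrt t)
      (fun i => by simp only [hessGrad, Finset.sum_div, mul_div_assoc])
      (by simp_rw [div_pow, hr2]; rw [← Finset.sum_div, ← ht, div_self h0.ne'])
      (a := μ / t) (by
        rw [hμ, hessGradGrad, Finset.sum_div]
        refine Finset.sum_congr rfl fun i _ => ?_
        rw [div_mul_div_comm, ← sq, hr2])
    simp_rw [div_pow, hr2] at h1
    rw [← Finset.sum_div, ← hn] at h1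
    set h := ∑ i, partialD2 i i u x with hh
    have hH : meanCurv u x = w⁻¹ * h + w⁻¹ ^ 3 * μ := meanCurv_eq hu hs
    set H := meanCurv u x
    set a := μ / (t * w ^ 3) with ha
    set b := (n + μ ^ 2 / w ^ 2) / (t * w ^ 4) - a ^ 2 with hb
    have htw : t = 1 - w ^ 2 := by linarith
    have hb0 : 0 ≤ b := by
      have : b = (t * n - μ ^ 2) / (t ^ 2 * w ^ 4) := by
        rw [hb, ha]
        field_simp
        rw [htw]
        ring
      rw [this]
      exact div_nonneg (by linarith) (by positivity)
    have hA : a ^ 2 + 2 * b + (H - a) ^ 2 / N ≤ secondFormSq u x := by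
      have e1 : H - a = (h - μ / t) / w := by
        rw [hH, ha]
        field_simp
        rw [htw]
        ring
      have e2 : a ^ 2 + 2 * b + (H - a) ^ 2 / N =
          (2 * (n / t) - μ ^ 2 / t ^ 2 + (h - μ / t) ^ 2 / N
            + 2 * n / w ^ 2 + μ ^ 2 / w ^ 4) / w ^ 2 := by
        rw [e1, div_pow, hb, ha]
        field_simp
        rw [htw]
        ring
      rw [e2, secondFormSq]
      gcongr
    have := quadratic_bound hN' hγ hγN ht0 ht1 hb0 hA
    have e3 : (γ + 1) * (n + μ ^ 2 / w ^ 2 - H * μ * w) / w ^ 4 =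
        (γ + 1) * t * (a ^ 2 + b - H * a) := by
      rw [hb, ha]
      field_simp
      ring
    rw [e3]
    exact this

/-- With `z = u(x) - u(x₀)`, expanding `|x - x₀ - z ∇u|² ≥ 0` gives `(P + z v)² ≤ l² + P²`. -/
lemma abs_normalPart_add_le (hs : ‖gradient u x‖ < 1) :
    |normalPart u x₀ x + (u x - u x₀) * v u x| ≤
      Real.sqrt (lorentzSq u x₀ x) + |normalPart u x₀ x| := by
  have hv := v_pos hs
  set z := u x - u x₀ with hz
  set P := normalPart u x₀ x with hP
  have hQ : supportFn u x₀ x = P * v u x := by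
    rw [hP, normalPart, div_mul_cancel₀ _ hv.ne']
  have h0 : 0 ≤ ∑ i, ((x i - x₀ i) - z * partialD i u x) ^ 2 := by positivity
  have h1 : ∑ i, ((x i - x₀ i) - z * partialD i u x) ^ 2 =
      lorentzSq u x₀ x + z ^ 2 - 2 * z * (supportFn u x₀ x + z) + z ^ 2 * (1 - v u x ^ 2) := by
    rw [lorentzSq, norm_sub_sq_eq_sum, ← sum_partialD_mul_coord, ← sum_partialD_sq hs,
      Finset.mul_sum, Finset.mul_sum, ← hz, sub_add_cancel, ← Finset.sum_sub_distrib,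
      ← Finset.sum_add_distrib]
    exact Finset.sum_congr rfl fun i _ => by ring
  have h2 : (P + z * v u x) ^ 2 ≤ lorentzSq u x₀ x + P ^ 2 := by
    rw [h1, hQ] at h0
    nlinarith
  have h3 : lorentzSq u x₀ x ≤ Real.sqrt (lorentzSq u x₀ x) ^ 2 := by
    rw [Real.sq_sqrt']
    exact le_max_left _ _
  refine abs_le_of_sq_le_sq (h2.trans ?_)
    (add_nonneg (Real.sqrt_nonneg _) (abs_nonneg _))
  nlinarith [sq_abs P, mul_nonneg (Real.sqrt_nonneg (lorentzSq u x₀ x)) (abs_nonneg P)]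

lemma meanCurv_eq_neg (x : E N) : meanCurv u x = -Qminus u x := by
  simp [meanCurv, Qminus, divergence, gradient_apply]
  rfl

end PointwiseEstimates

/-! ### Lorentz balls and their compactness -/

section LorentzBalls

variable {u : E N → ℝ} {x₀ x : E N}

lemma lorentzDist_eq : lorentzDist u x x₀ = Real.sqrt (lorentzSq u x₀ x) := rfl

lemma lorentzSq_nonneg (hs : StrictlySpacelike u) : 0 ≤ lorentzSq u x₀ x := by
  unfold lorentzSq
  rcases eq_or_ne x x₀ with rfl | h
  · simp
  · have := hs.spacelike x x₀ h
    nlinarith [abs_nonneg (u x - u x₀), sq_abs (u x - u x₀)]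

lemma lorentzSq_pos (hs : StrictlySpacelike u) (h : x ≠ x₀) : 0 < lorentzSq u x₀ x := by
  unfold lorentzSq
  have := hs.spacelike x x₀ h
  nlinarith [abs_nonneg (u x - u x₀), sq_abs (u x - u x₀)]

lemma mem_K_iff {R : ℝ} (hR : 0 < R) : x ∈ K u R x₀ ↔ lorentzSq u x₀ x < R ^ 2 := by
  rw [K, Set.mem_ofPred_eq, lorentzDist_eq, Real.sqrt_lt' hR]

lemma continuous_lorentzSq (hu : Continuous u) : Continuous (lorentzSq u x₀) := by
  unfold lorentzSq
  fun_prop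

lemma isOpen_K (hu : Continuous u) (R : ℝ) : IsOpen (K u R x₀) :=
  isOpen_lt (continuous_lorentzSq hu).sqrt continuous_const

lemma measurableSet_K (hu : Continuous u) (R : ℝ) : MeasurableSet (K u R x₀) :=
  (isOpen_K hu R).measurableSet

/-- Continuity and decay bound `|u|` by some `M`, so `l² ≥ |x - x₀|² - 4M²`. All uses of the decay
of `u` pass through this compactness. -/
lemma isCompact_lorentzSq_le (hu : Continuous u) (h0 : Tendsto u (cocompact (E N)) (𝓝 0))
    (r : ℝ) : IsCompact {x | lorentzSq u x₀ x ≤ r} := by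
  obtain ⟨M, hM⟩ : ∃ M, ∀ x, |u x| ≤ M := by
    have h1 : ∀ᶠ x in cocompact (E N), |u x| < 1 := by
      have := h0.abs
      rw [abs_zero] at this
      exact this.eventually (gt_mem_nhds one_pos)
    obtain ⟨S, hS, hSc⟩ := mem_cocompact.1 h1
    obtain ⟨M, hM⟩ := hS.exists_bound_of_continuousOn hu.continuousOn
    refine ⟨max M 1, fun x => ?_⟩
    by_cases hx : x ∈ S
    · exact (hM x hx).trans (le_max_left _ _)
    · exact (le_of_lt (hSc hx)).trans (le_max_right _ _)
  refine Metric.isCompact_of_isClosed_isBounded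
    (isClosed_le (continuous_lorentzSq hu) continuous_const) ?_
  refine (Metric.isBounded_closedBall (x := x₀) (r := Real.sqrt (r + (2 * M) ^ 2))).subset ?_
  intro x hx
  rw [Metric.mem_closedBall, dist_eq_norm]
  apply Real.le_sqrt_of_sq_le
  have h2 : |u x - u x₀| ≤ 2 * M := by
    have := abs_sub (u x) (u x₀)
    linarith [hM x, hM x₀]
  have h3 : (u x - u x₀) ^ 2 ≤ (2 * M) ^ 2 := sq_le_sq' (abs_le.1 h2).1 (abs_le.1 h2).2
  simp only [Set.mem_ofPred_eq, lorentzSq] at hx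
  linarith

lemma integrableOn_K (hu : Continuous u) (h0 : Tendsto u (cocompact (E N)) (𝓝 0)) {R : ℝ}
    (hR : 0 < R) {f : E N → ℝ} (hf : Continuous f) : IntegrableOn f (K u R x₀) := by
  refine (hf.continuousOn.integrableOn_compact (isCompact_lorentzSq_le (x₀ := x₀) hu h0 (R ^ 2))).mono_set
    fun x hx => ?_
  exact ((mem_K_iff hR).1 hx).le

end LorentzBalls

/-! ### Test functions with a discontinuous derivative -/

section Kernels

/-- The test function `φ` with `φ' = -χ` vanishing at `T`. -/
def kernelFirst (χ : ℝ → ℝ) (T t : ℝ) : ℝ := ∫ τ in t..T, χ τ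

/-- The test function `Ψ` with `Ψ' = -φ/2` vanishing at `T`. -/
def kernelSecond (χ : ℝ → ℝ) (T t : ℝ) : ℝ := ∫ τ in t..T, χ τ * ((τ - t) / 2)

variable {χ : ℝ → ℝ} {T t : ℝ}

lemma hasDerivAt_kernelFirst (hχ : Continuous χ) : HasDerivAt (kernelFirst χ T) (-χ t) t :=
  intervalIntegral.integral_hasDerivAt_left (hχ.intervalIntegrable _ _)
    (hχ.stronglyMeasurableAtFilter _ _) hχ.continuousAt

lemma hasDerivAt_kernelSecond (hχ : Continuous χ) :
    HasDerivAt (kernelSecond χ T) (-(kernelFirst χ T t / 2)) t := by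
  -- The variable `t` occurs in the integrand too; taking it out leaves two integrals whose
  -- derivatives come from the endpoint alone, and the terms `χ(t) t` cancel.
  have h0 : kernelSecond χ T =
      fun t => (kernelFirst (fun τ => χ τ * τ) T t - t * kernelFirst χ T t) / 2 := by
    ext s
    simp only [kernelSecond, kernelFirst]
    rw [← intervalIntegral.integral_const_mul, ← intervalIntegral.integral_sub,
      ← intervalIntegral.integral_div]
    · congr 1
      ext τ
      ring
    · exact (hχ.mul continuous_id).intervalIntegrable _ _
    · exact (continuous_const.mul hχ).intervalIntegrable _ _
  rw [h0]
  have h1 : HasDerivAt (kernelFirst (fun τ => χ τ * τ) T) (-(χ t * t)) t :=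
    hasDerivAt_kernelFirst (hχ.mul continuous_id)
  have := (h1.sub ((hasDerivAt_id t).mul (hasDerivAt_kernelFirst (T := T) hχ))).div_const 2
  refine this.congr_deriv ?_
  simp only [id_eq]
  ring

lemma kernelFirst_eq_zero (hχ : ∀ t, T ≤ t → χ t = 0) (ht : T ≤ t) : kernelFirst χ T t = 0 := by
  rw [kernelFirst, intervalIntegral.integral_symm,
    intervalIntegral.integral_zero_ae (Eventually.of_forall fun τ hτ => ?_), neg_zero]
  rw [Set.uIoc_of_le ht] at hτ
  exact hχ _ hτ.1.le

lemma kernelSecond_eq_zero (hχ : ∀ t, T ≤ t → χ t = 0) (ht : T ≤ t) :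
    kernelSecond χ T t = 0 := by
  rw [kernelSecond, intervalIntegral.integral_symm,
    intervalIntegral.integral_zero_ae (Eventually.of_forall fun τ hτ => ?_), neg_zero]
  rw [Set.uIoc_of_le ht] at hτ
  rw [hχ _ hτ.1.le, zero_mul]

/-- A continuous approximation of the indicator function of `[e, T)`. -/
def cutoff (e T : ℝ) (n : ℕ) (τ : ℝ) : ℝ :=
  max 0 (min 1 (n * (τ - e) + 1)) * max 0 (min 1 (n * (T - τ)))

lemma continuous_cutoff (e T : ℝ) (n : ℕ) : Continuous (cutoff e T n) := by
  unfold cutoff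
  fun_prop

lemma abs_cutoff_le (e T : ℝ) (n : ℕ) (τ : ℝ) : |cutoff e T n τ| ≤ 1 := by
  unfold cutoff
  rw [abs_of_nonneg (by positivity)]
  exact mul_le_one₀ (max_le zero_le_one (min_le_left _ _)) (le_max_left _ _)
    (max_le zero_le_one (min_le_left _ _))

lemma cutoff_eq_zero (e : ℝ) (n : ℕ) {τ : ℝ} (h : T ≤ τ) : cutoff e T n τ = 0 := by
  unfold cutoff
  have : (n : ℝ) * (T - τ) ≤ 0 := mul_nonpos_of_nonneg_of_nonpos n.cast_nonneg (by linarith)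
  rw [max_eq_left (min_le_of_right_le this : min 1 ((n : ℝ) * (T - τ)) ≤ 0), mul_zero]

/-- The left ramp already equals 1 at `e`, while the right ramp is still 0 at `T`. So convergence
holds at every `τ`, endpoints included, and the limit is the half-open indicator. -/
lemma tendsto_cutoff (e T τ : ℝ) (g : ℝ → ℝ) :
    Tendsto (fun n => cutoff e T n τ * g τ) atTop (𝓝 ((Set.Ico e T).indicator g τ)) := by
  have hlim : ∀ a : ℝ, 0 < a → Tendsto (fun n : ℕ => (n : ℝ) * a) atTop atTop := fun a ha =>
    tendsto_natCast_atTop_atTop.atTop_mul_const ha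
  apply tendsto_const_nhds.congr'
  by_cases h1 : τ < e
  · filter_upwards [(hlim (e - τ) (by linarith)).eventually_ge_atTop 1] with n hn
    have h2 : (n : ℝ) * (τ - e) + 1 ≤ 0 := by nlinarith
    rw [Set.indicator_of_notMem (fun h : τ ∈ Set.Ico e T => absurd h.1 (not_le.2 h1)),
      cutoff,
      max_eq_left (min_le_of_right_le h2), zero_mul, zero_mul]
  · by_cases h2 : T ≤ τ
    · filter_upwards with n
      rw [Set.indicator_of_notMem (fun h : τ ∈ Set.Ico e T => absurd h.2 (not_lt.2 h2)),
        cutoff_eq_zero e n h2,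
        zero_mul]
    · push Not at h1 h2
      filter_upwards [(hlim (T - τ) (by linarith)).eventually_ge_atTop 1] with n hn
      have h3 : 1 ≤ (n : ℝ) * (τ - e) + 1 := by
        have : 0 ≤ (n : ℝ) * (τ - e) := mul_nonneg n.cast_nonneg (by linarith)
        linarith
      rw [Set.indicator_of_mem (show τ ∈ Set.Ico e T from ⟨h1, h2⟩), cutoff, min_eq_left h3, min_eq_left hn]
      simp

lemma abs_kernelFirst_le {M : ℝ} (hχ : ∀ τ, 0 ≤ τ → |χ τ| ≤ M) (ht : 0 ≤ t) (htT : t ≤ T) :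
    |kernelFirst χ T t| ≤ M * T := by
  have hM : 0 ≤ M := (abs_nonneg _).trans (hχ 0 le_rfl)
  have := intervalIntegral.norm_integral_le_of_norm_le_const (a := t) (b := T) (f := χ) (C := M)
    fun τ hτ => by
      rw [Set.uIoc_of_le htT] at hτ
      exact hχ τ (ht.trans hτ.1.le)
  rw [Real.norm_eq_abs, abs_of_nonneg (by linarith : 0 ≤ T - t)] at this
  exact this.trans (by nlinarith)

lemma abs_kernelSecond_le {M : ℝ} (hχ : ∀ τ, 0 ≤ τ → |χ τ| ≤ M) (ht : 0 ≤ t) (htT : t ≤ T) :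
    |kernelSecond χ T t| ≤ M * T * T := by
  have hM : 0 ≤ M := (abs_nonneg _).trans (hχ 0 le_rfl)
  have := intervalIntegral.norm_integral_le_of_norm_le_const (a := t) (b := T)
    (f := fun τ => χ τ * ((τ - t) / 2)) (C := M * T)
    fun τ hτ => by
      rw [Set.uIoc_of_le htT] at hτ
      rw [Real.norm_eq_abs, abs_mul]
      refine mul_le_mul (hχ τ (ht.trans hτ.1.le)) ?_ (abs_nonneg _) hM
      rw [abs_of_nonneg (by linarith [hτ.1])]
      linarith [hτ.1, hτ.2]
  rw [Real.norm_eq_abs, abs_of_nonneg (by linarith : 0 ≤ T - t)] at this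
  exact this.trans (by nlinarith [mul_nonneg hM (ht.trans htT)])

variable {u : E N → ℝ} {x₀ : E N}

lemma continuous_normalPart (hu : ContDiff ℝ 3 u) (hs : ∀ x, ‖gradient u x‖ < 1) :
    Continuous (normalPart u x₀) :=
  (contDiff_supportFn hu).continuous.div
    (contDiff_v hu hs).continuous fun x => (v_pos (hs x)).ne'

lemma continuous_coeffFirst (hu : ContDiff ℝ 3 u) (hs : ∀ x, ‖gradient u x‖ < 1) (γ : ℝ) :
    Continuous (coeffFirst γ u x₀) := by
  have h1 := (contDiff_v_rpow hu hs (γ + 1)).continuous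
  have h2 := (contDiff_meanCurv hu hs).continuous
  have h3 : Continuous (normalPart u x₀) := continuous_normalPart hu hs
  have h4 := hu.continuous
  have h5 := (contDiff_v hu hs).continuous
  unfold coeffFirst
  fun_prop

lemma continuous_coeffDeriv (hu : ContDiff ℝ 3 u) (hs : ∀ x, ‖gradient u x‖ < 1) (γ : ℝ) :
    Continuous (coeffDeriv γ u x₀) := by
  have h1 := (contDiff_v_rpow hu hs (γ + 1)).continuous
  have h3 := continuous_normalPart (x₀ := x₀) hu hs
  have h4 := continuous_lorentzSq (x₀ := x₀) hu.continuous
  unfold coeffDeriv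
  fun_prop

lemma continuous_partialD2 (hu : ContDiff ℝ 3 u) (i j : Fin N) : Continuous (partialD2 i j u) :=
  (contDiff_partialD (m := 1) j (contDiff_partialD (m := 2) i hu (by norm_num))
    (by norm_num)).continuous

lemma continuous_hessGrad (hu : ContDiff ℝ 3 u) (i : Fin N) : Continuous (hessGrad u i) :=
  continuous_finsetSum _ fun j _ => (continuous_partialD2 hu i j).mul
    (contDiff_partialD (m := 2) j hu (by norm_num)).continuous

lemma continuous_hessGradGrad (hu : ContDiff ℝ 3 u) : Continuous (hessGradGrad u) :=
  continuous_finsetSum _ fun j _ =>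
    (contDiff_partialD (m := 2) j hu (by norm_num)).continuous.mul (continuous_hessGrad hu j)

lemma continuous_secondFormSq (hu : ContDiff ℝ 3 u) (hs : ∀ x, ‖gradient u x‖ < 1) :
    Continuous (secondFormSq u) := by
  have h1 := continuous_partialD2 hu
  have h2 := continuous_hessGrad hu
  have h3 := continuous_hessGradGrad hu
  have h5 := (contDiff_v hu hs).continuous
  have h6 : ∀ x, v u x ≠ 0 := fun x => (v_pos (hs x)).ne'
  unfold secondFormSq
  refine Continuous.div ?_ (h5.pow 2) fun x => pow_ne_zero _ (h6 x)
  refine Continuous.add (Continuous.add (by fun_prop) ?_) ?_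
  · exact Continuous.div (by fun_prop) (h5.pow 2) fun x => pow_ne_zero _ (h6 x)
  · exact Continuous.div (by fun_prop) (h5.pow 4) fun x => pow_ne_zero _ (h6 x)

lemma continuous_coeffSecond (hu : ContDiff ℝ 3 u) (hs : ∀ x, ‖gradient u x‖ < 1) (γ : ℝ) :
    Continuous (coeffSecond γ u) := by
  have h0 := (contDiff_v_rpow hu hs (γ + 1)).continuous
  have h1 := continuous_secondFormSq hu hs
  have h2 := continuous_hessGrad hu
  have h3 := continuous_hessGradGrad hu
  have h4 := (contDiff_meanCurv hu hs).continuous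
  have h5 := (contDiff_v hu hs).continuous
  have h6 : ∀ x, v u x ≠ 0 := fun x => (v_pos (hs x)).ne'
  unfold coeffSecond
  refine Continuous.mul (by fun_prop) (Continuous.add (by fun_prop) ?_)
  refine Continuous.div ?_ (h5.pow 4) fun x => pow_ne_zero _ (h6 x)
  refine continuous_const.mul (Continuous.sub (Continuous.add (by fun_prop) ?_) (by fun_prop))
  exact Continuous.div (by fun_prop) (h5.pow 2) fun x => pow_ne_zero _ (h6 x)

/-- The integral identity for a test function whose derivative jumps. -/
lemma integral_kernel_eq_zero (hu : ContDiff ℝ 3 u) (hs : StrictlySpacelike u)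
    (h0 : Tendsto u (cocompact (E N)) (𝓝 0)) (γ : ℝ) {h : ℝ → ℝ} (hh : Continuous h) (e : ℝ)
    {T : ℝ} (hT : 0 < T) :
    Integrable (fun x =>
      kernelFirst ((Set.Ico e T).indicator h) T (lorentzSq u x₀ x) * coeffFirst γ u x₀ x
      - (Set.Ico e T).indicator h (lorentzSq u x₀ x) * coeffDeriv γ u x₀ x
      + kernelSecond ((Set.Ico e T).indicator h) T (lorentzSq u x₀ x) * coeffSecond γ u x) ∧
    ∫ x, (kernelFirst ((Set.Ico e T).indicator h) T (lorentzSq u x₀ x) * coeffFirst γ u x₀ x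
      - (Set.Ico e T).indicator h (lorentzSq u x₀ x) * coeffDeriv γ u x₀ x
      + kernelSecond ((Set.Ico e T).indicator h) T (lorentzSq u x₀ x) * coeffSecond γ u x) = 0 := by
  have hg := hs.norm_gradient_lt
  have hcomp := isCompact_lorentzSq_le (x₀ := x₀) hu.continuous h0 T
  -- The identity involves `χ` but not its derivative, so it passes to the limit along continuous `χ
  -- n` by dominated convergence, everything being bounded and supported in a compact sublevel set.
  set χ : ℕ → ℝ → ℝ := fun n τ => cutoff e T n τ * h τ with hχ
  have hχc : ∀ n, Continuous (χ n) := fun n => (continuous_cutoff e T n).mul hh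
  have hχ0 : ∀ n t, T ≤ t → χ n t = 0 := fun n t ht => by
    simp only [hχ, cutoff_eq_zero e n ht, zero_mul]
  obtain ⟨M, hM⟩ := (isCompact_Icc (a := (0 : ℝ)) (b := T)).exists_bound_of_continuousOn
    hh.continuousOn
  have hM0 : 0 ≤ M := (norm_nonneg _).trans (hM 0 ⟨le_rfl, hT.le⟩)
  have hχM : ∀ n τ, 0 ≤ τ → |χ n τ| ≤ M := fun n τ hτ => by
    rcases le_total T τ with h1 | h1
    · rw [hχ0 n τ h1, abs_zero]; exact hM0
    · simp only [hχ]
      rw [abs_mul]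
      calc _ ≤ 1 * M := mul_le_mul (abs_cutoff_le _ _ _ _) (hM τ ⟨hτ, h1⟩) (abs_nonneg _)
            zero_le_one
        _ = M := one_mul M
  have hχlim : ∀ τ, Tendsto (fun n => χ n τ) atTop (𝓝 ((Set.Ico e T).indicator h τ)) :=
    fun τ => tendsto_cutoff e T τ h
  set a := coeffFirst γ u x₀ with ha
  set b := coeffDeriv γ u x₀ with hb
  set c := coeffSecond γ u with hc
  have hac : Continuous a := continuous_coeffFirst hu hg γ
  have hbc : Continuous b := continuous_coeffDeriv hu hg γ
  have hcc : Continuous c := continuous_coeffSecond hu hg γ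
  have hL := continuous_lorentzSq (x₀ := x₀) hu.continuous
  have hk1 : ∀ n, Continuous (kernelFirst (χ n) T) := fun n =>
    continuous_iff_continuousAt.2 fun t => (hasDerivAt_kernelFirst (hχc n)).continuousAt
  have hk2 : ∀ n, Continuous (kernelSecond (χ n) T) := fun n =>
    continuous_iff_continuousAt.2 fun t => (hasDerivAt_kernelSecond (hχc n)).continuousAt
  have hzero : ∀ n, ∫ x, (kernelFirst (χ n) T (lorentzSq u x₀ x) * a x
      - χ n (lorentzSq u x₀ x) * b x + kernelSecond (χ n) T (lorentzSq u x₀ x) * c x) = 0 :=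
    fun n => integral_test_eq_zero hu hg (hχc n)
      (fun t => hasDerivAt_kernelFirst (hχc n)) (fun t => hasDerivAt_kernelSecond (hχc n))
      (fun t ht => kernelFirst_eq_zero (hχ0 n) ht) (fun t ht => kernelSecond_eq_zero (hχ0 n) ht)
      hcomp
  set F : ℕ → E N → ℝ := fun n x => kernelFirst (χ n) T (lorentzSq u x₀ x) * a x
    - χ n (lorentzSq u x₀ x) * b x + kernelSecond (χ n) T (lorentzSq u x₀ x) * c x with hF
  set bound : E N → ℝ := Set.indicator {x | lorentzSq u x₀ x ≤ T}
    fun x => M * T * |a x| + M * |b x| + M * T * T * |c x| with hbound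
  have hFm : ∀ n, AEStronglyMeasurable (F n) volume := fun n => by
    have := hk1 n; have := hk2 n; have := hχc n
    exact Continuous.aestronglyMeasurable (by fun_prop)
  have hbi : Integrable bound :=
    (integrable_indicator_iff hcomp.isClosed.measurableSet).2
      (ContinuousOn.integrableOn_compact hcomp (by fun_prop))
  suffices hpt : (∀ n x, ‖F n x‖ ≤ bound x) ∧ ∀ x, Tendsto (fun n => F n x) atTop
      (𝓝 (kernelFirst ((Set.Ico e T).indicator h) T (lorentzSq u x₀ x) * a x
        - (Set.Ico e T).indicator h (lorentzSq u x₀ x) * b x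
        + kernelSecond ((Set.Ico e T).indicator h) T (lorentzSq u x₀ x) * c x)) by
    obtain ⟨hFb, hFl⟩ := hpt
    refine ⟨⟨aestronglyMeasurable_of_tendsto_ae atTop hFm (Eventually.of_forall hFl),
      hasFiniteIntegral_of_dominated_convergence hbi.hasFiniteIntegral
        (fun n => Eventually.of_forall (hFb n)) (Eventually.of_forall hFl)⟩, ?_⟩
    have hlim := tendsto_integral_of_dominated_convergence bound hFm hbi
      (fun n => Eventually.of_forall (hFb n)) (Eventually.of_forall hFl)
    simp_rw [hF, hzero] at hlim
    exact tendsto_nhds_unique hlim tendsto_const_nhds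
  refine ⟨fun n x => ?_, fun x => ?_⟩
  · have hx0 : 0 ≤ lorentzSq u x₀ x := lorentzSq_nonneg hs
    by_cases hx : lorentzSq u x₀ x ≤ T
    · rw [hbound, Set.indicator_of_mem (show x ∈ {x | lorentzSq u x₀ x ≤ T} from hx)]
      refine (norm_add_le _ _).trans (add_le_add ((norm_sub_le _ _).trans (add_le_add ?_ ?_)) ?_)
      all_goals
        rw [Real.norm_eq_abs, abs_mul]
        refine mul_le_mul_of_nonneg_right ?_ (abs_nonneg _)
      · exact abs_kernelFirst_le (hχM n) hx0 hx
      · exact hχM n _ hx0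
      · exact abs_kernelSecond_le (hχM n) hx0 hx
    · rw [hbound, Set.indicator_of_notMem (show x ∉ {x | lorentzSq u x₀ x ≤ T} from hx)]
      have hx' : T ≤ lorentzSq u x₀ x := (not_le.1 hx).le
      simp only [hF]
      rw [kernelFirst_eq_zero (hχ0 n) hx', kernelSecond_eq_zero (hχ0 n) hx', hχ0 n _ hx']
      simp
  · have hx0 : 0 ≤ lorentzSq u x₀ x := lorentzSq_nonneg hs
    by_cases hx : lorentzSq u x₀ x ≤ T
    · refine (((?_ : Tendsto _ _ _).mul_const _).sub ((hχlim _).mul_const _)).add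
        ((?_ : Tendsto _ _ _).mul_const _)
      · refine intervalIntegral.tendsto_integral_filter_of_dominated_convergence (fun _ => M)
          (Eventually.of_forall fun n => (hχc n).aestronglyMeasurable)
          (Eventually.of_forall fun n => Eventually.of_forall fun τ hτ => ?_)
          intervalIntegrable_const (Eventually.of_forall fun τ _ => hχlim τ)
        rw [Set.uIoc_of_le hx] at hτ
        exact hχM n τ (hx0.trans hτ.1.le)
      · refine intervalIntegral.tendsto_integral_filter_of_dominated_convergence
          (fun τ => M * |(τ - lorentzSq u x₀ x) / 2|)
          (Eventually.of_forall fun n => ?_)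
          (Eventually.of_forall fun n => Eventually.of_forall fun τ hτ => ?_)
          (Continuous.intervalIntegrable (by fun_prop) _ _)
          (Eventually.of_forall fun τ _ => (hχlim τ).mul_const _)
        · have := hχc n
          exact Continuous.aestronglyMeasurable (by fun_prop)
        · rw [Set.uIoc_of_le hx] at hτ
          rw [Real.norm_eq_abs, abs_mul]
          exact mul_le_mul_of_nonneg_right (hχM n τ (hx0.trans hτ.1.le)) (abs_nonneg _)
    · have hx' : T ≤ lorentzSq u x₀ x := (not_le.1 hx).le
      have hi : ∀ t, T ≤ t → (Set.Ico e T).indicator h t = 0 := fun t ht =>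
        Set.indicator_of_notMem (fun h' => absurd h'.2 (not_lt.2 ht)) _
      simp_rw [hF, kernelFirst_eq_zero (hχ0 _) hx', kernelSecond_eq_zero (hχ0 _) hx',
        hχ0 _ _ hx', kernelFirst_eq_zero hi hx', kernelSecond_eq_zero hi hx', hi _ hx']
      exact tendsto_const_nhds

end Kernels

/-! ### The kernel `N σ^(-N-1) e^(-κσ)` and the main pointwise inequality -/

section RadialKernel

/-- The radial kernel. -/
def radialKernel (n : ℕ) (κ σ : ℝ) : ℝ := n / σ ^ (n + 1) * Real.exp (-κ * σ)

variable {n : ℕ} {κ m l R : ℝ}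

lemma intervalIntegrable_of_continuousOn_Ioi {f : ℝ → ℝ} (hf : ContinuousOn f (Set.Ioi 0))
    (hm : 0 < m) (hmR : m ≤ R) : IntervalIntegrable f volume m R := by
  refine (hf.mono fun x hx => ?_).intervalIntegrable
  rw [Set.uIcc_of_le hmR] at hx
  exact hm.trans_le hx.1

lemma continuousOn_radialKernel : ContinuousOn (radialKernel n κ) (Set.Ioi 0) := by
  unfold radialKernel
  refine ContinuousOn.mul (ContinuousOn.div (by fun_prop) (by fun_prop) fun x hx => ?_)
    (by fun_prop)
  exact pow_ne_zero _ (Set.mem_Ioi.1 hx).ne'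

lemma continuousOn_exp_div_pow :
    ContinuousOn (fun σ : ℝ => Real.exp (-κ * σ) / σ ^ n) (Set.Ioi 0) := by
  refine ContinuousOn.div (by fun_prop) (by fun_prop) fun x hx => ?_
  exact pow_ne_zero _ (Set.mem_Ioi.1 hx).ne'

lemma continuousOn_inv_pow : ContinuousOn (fun σ : ℝ => (σ ^ n)⁻¹) (Set.Ioi 0) :=
  ContinuousOn.inv₀ (by fun_prop) fun _ hx => pow_ne_zero _ (Set.mem_Ioi.1 hx).ne'

lemma radialKernel_nonneg {σ : ℝ} (hσ : 0 < σ) : 0 ≤ radialKernel n κ σ := by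
  unfold radialKernel
  positivity

/-- `-e^(-κσ)/σ^n` is a primitive of the kernel up to the term in `κ`. That negative term, present
only because of the exponential, is what absorbs the drift in `kernel_bound`. -/
lemma integral_radialKernel (hm : 0 < m) (hmR : m ≤ R) :
    ∫ σ in m..R, radialKernel n κ σ = Real.exp (-κ * m) / m ^ n - Real.exp (-κ * R) / R ^ n
      - κ * ∫ σ in m..R, Real.exp (-κ * σ) / σ ^ n := by
  have hd : ∀ σ ∈ Set.uIcc m R, HasDerivAt (fun σ : ℝ => -(Real.exp (-κ * σ) / σ ^ n))
      (radialKernel n κ σ + κ * (Real.exp (-κ * σ) / σ ^ n)) σ := by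
    intro σ hσ
    rw [Set.uIcc_of_le hmR] at hσ
    have h0 : 0 < σ := hm.trans_le hσ.1
    have h1 : HasDerivAt (fun σ : ℝ => Real.exp (-κ * σ)) (Real.exp (-κ * σ) * -κ) σ := by
      have := ((hasDerivAt_id σ).const_mul (-κ)).exp
      simpa using this
    have h2 := (h1.div (hasDerivAt_pow n σ) (pow_ne_zero n h0.ne')).neg
    refine h2.congr_deriv ?_
    unfold radialKernel
    rcases n with _ | k
    · simp
      ring
    · simp only [Nat.add_sub_cancel]
      field_simp
      ring
  have h1 : IntervalIntegrable (radialKernel n κ) volume m R :=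
    intervalIntegrable_of_continuousOn_Ioi continuousOn_radialKernel hm hmR
  have h2 : IntervalIntegrable (fun σ => κ * (Real.exp (-κ * σ) / σ ^ n)) volume m R :=
    (intervalIntegrable_of_continuousOn_Ioi continuousOn_exp_div_pow hm hmR).const_mul κ
  have := intervalIntegral.integral_eq_sub_of_hasDerivAt hd (h1.add h2)
  rw [intervalIntegral.integral_add h1 h2, intervalIntegral.integral_const_mul] at this
  linarith

lemma integral_radialKernel_nonneg (hm : 0 < m) (hmR : m ≤ R) :
    0 ≤ ∫ σ in m..R, radialKernel n κ σ :=
  intervalIntegral.integral_nonneg hmR fun _ hσ => radialKernel_nonneg (hm.trans_le hσ.1)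

lemma integral_radialKernel_le (hκ : 0 ≤ κ) (hm : 0 < m) (hmR : m ≤ R) :
    ∫ σ in m..R, radialKernel n κ σ ≤ Real.exp (-κ * m) / m ^ n := by
  rw [integral_radialKernel hm hmR]
  have h1 : 0 ≤ ∫ σ in m..R, Real.exp (-κ * σ) / σ ^ n :=
    intervalIntegral.integral_nonneg hmR fun σ hσ => by
      have := hm.trans_le hσ.1
      positivity
  have h2 : 0 ≤ Real.exp (-κ * R) / R ^ n := by
    have := hm.trans_le hmR
    positivity
  nlinarith [mul_nonneg hκ h1]

lemma exp_neg_mul_le_one {σ : ℝ} (hκ : 0 ≤ κ) (hσ : 0 ≤ σ) : Real.exp (-κ * σ) ≤ 1 := by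
  rw [Real.exp_le_one_iff]
  nlinarith

lemma mul_integral_radialKernel_le (hm : 0 < m) (hmR : m ≤ R) (hlm : l ≤ m) :
    l * ∫ σ in m..R, radialKernel n κ σ ≤ n * ∫ σ in m..R, Real.exp (-κ * σ) / σ ^ n := by
  rw [← intervalIntegral.integral_const_mul, ← intervalIntegral.integral_const_mul]
  refine intervalIntegral.integral_mono_on hmR
    ((intervalIntegrable_of_continuousOn_Ioi continuousOn_radialKernel hm hmR).const_mul l)
    ((intervalIntegrable_of_continuousOn_Ioi continuousOn_exp_div_pow hm hmR).const_mul _)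
    fun σ hσ => ?_
  have h0 : 0 < σ := hm.trans_le hσ.1
  have : (n : ℝ) * (Real.exp (-κ * σ) / σ ^ n) = σ * radialKernel n κ σ := by
    unfold radialKernel
    field_simp
    ring
  rw [this]
  exact mul_le_mul_of_nonneg_right (hlm.trans hσ.1) (radialKernel_nonneg h0)

lemma integral_exp_div_pow_le (hκ : 0 ≤ κ) (hm : 0 < m) (hmR : m ≤ R) :
    ∫ σ in m..R, Real.exp (-κ * σ) / σ ^ n ≤ ∫ σ in m..R, (σ ^ n)⁻¹ := by
  refine intervalIntegral.integral_mono_on hmR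
    (intervalIntegrable_of_continuousOn_Ioi continuousOn_exp_div_pow hm hmR)
    (intervalIntegrable_of_continuousOn_Ioi continuousOn_inv_pow hm hmR) fun σ hσ => ?_
  have h0 : 0 < σ := hm.trans_le hσ.1
  rw [← one_div]
  gcongr
  exact exp_neg_mul_le_one hκ h0.le

lemma integral_exp_div_pow_nonneg (hm : 0 < m) (hmR : m ≤ R) :
    0 ≤ ∫ σ in m..R, Real.exp (-κ * σ) / σ ^ n :=
  intervalIntegral.integral_nonneg hmR fun σ hσ => by
    have := hm.trans_le hσ.1
    positivity

lemma continuousOn_radialKernel_second :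
    ContinuousOn (fun σ => radialKernel n κ σ * ((σ ^ 2 - l ^ 2) / 2)) (Set.Ioi 0) :=
  continuousOn_radialKernel.mul (by fun_prop)

lemma integral_radialKernel_second_nonneg (hm : 0 < m) (hmR : m ≤ R) (hl : 0 ≤ l) (hlm : l ≤ m) :
    0 ≤ ∫ σ in m..R, radialKernel n κ σ * ((σ ^ 2 - l ^ 2) / 2) :=
  intervalIntegral.integral_nonneg hmR fun σ hσ =>
    mul_nonneg (radialKernel_nonneg (hm.trans_le hσ.1)) (by nlinarith [hσ.1])

lemma integral_radialKernel_second_le (hκ : 0 ≤ κ) (hm : 0 < m) (hmR : m ≤ R) :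
    ∫ σ in m..R, radialKernel n κ σ * ((σ ^ 2 - l ^ 2) / 2) ≤
      n * R / 2 * ∫ σ in m..R, (σ ^ n)⁻¹ := by
  rw [← intervalIntegral.integral_const_mul]
  refine intervalIntegral.integral_mono_on hmR
    (intervalIntegrable_of_continuousOn_Ioi continuousOn_radialKernel_second hm hmR)
    ((intervalIntegrable_of_continuousOn_Ioi continuousOn_inv_pow hm hmR).const_mul _)
    fun σ hσ => ?_
  have h0 : 0 < σ := hm.trans_le hσ.1
  have h1 : radialKernel n κ σ ≤ n / σ ^ (n + 1) := by
    unfold radialKernel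
    exact mul_le_of_le_one_right (by positivity) (exp_neg_mul_le_one hκ h0.le)
  have h2 : n * R / 2 * (σ ^ n)⁻¹ = n / σ ^ (n + 1) * (σ * R / 2) := by
    rw [pow_succ]
    field_simp
  rw [h2]
  calc _ ≤ radialKernel n κ σ * (σ * R / 2) :=
        mul_le_mul_of_nonneg_left (by nlinarith [hσ.2, sq_nonneg l]) (radialKernel_nonneg h0)
    _ ≤ _ := mul_le_mul_of_nonneg_right h1 (by nlinarith [hσ.2])

/-- Only `σ ∈ [3R/4, R]` is kept. As `l ≤ R/2`, there `(σ² - l²)/2 ≥ (9/16 - 1/4) R²/2 = 5R²/32`,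
and the length `R/4` of the interval gives `5/128`. -/
lemma le_integral_radialKernel_second (hκ : 0 ≤ κ) (hR : 0 < R) (hm : 0 < m) (hmR : m ≤ R / 2)
    (hl : 0 ≤ l) (hlm : l ≤ m) :
    n * (5 / 128 * (R ^ 2 / R ^ n) * Real.exp (-κ * R)) ≤
      ∫ σ in m..R, radialKernel n κ σ * ((σ ^ 2 - l ^ 2) / 2) := by
  have h1 : ∫ σ in (3 * R / 4)..R, radialKernel n κ σ * ((σ ^ 2 - l ^ 2) / 2) ≤
      ∫ σ in m..R, radialKernel n κ σ * ((σ ^ 2 - l ^ 2) / 2) := by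
    refine intervalIntegral.integral_mono_interval (by linarith) (by linarith) le_rfl ?_
      (intervalIntegrable_of_continuousOn_Ioi continuousOn_radialKernel_second hm (by linarith))
    filter_upwards [ae_restrict_mem measurableSet_Ioc] with σ hσ
    exact mul_nonneg (radialKernel_nonneg (hm.trans hσ.1)) (by nlinarith [hσ.1])
  have h2 : ∫ σ in (3 * R / 4)..R, n / R ^ (n + 1) * Real.exp (-κ * R) * (5 / 32 * R ^ 2) ≤
      ∫ σ in (3 * R / 4)..R, radialKernel n κ σ * ((σ ^ 2 - l ^ 2) / 2) := by
    refine intervalIntegral.integral_mono_on (by linarith) intervalIntegrable_const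
      (intervalIntegrable_of_continuousOn_Ioi continuousOn_radialKernel_second (by linarith)
        (by linarith)) fun σ hσ => ?_
    have h0 : 0 < σ := lt_of_lt_of_le (by linarith) hσ.1
    have h3 : n / R ^ (n + 1) * Real.exp (-κ * R) ≤ radialKernel n κ σ := by
      unfold radialKernel
      have hσR := hσ.2
      have : -κ * R ≤ -κ * σ := by nlinarith
      gcongr
    refine mul_le_mul h3 ?_ (by positivity) (radialKernel_nonneg h0)
    nlinarith [hσ.1]
  refine le_trans (le_of_eq ?_) (h2.trans h1)
  rw [intervalIntegral.integral_const, smul_eq_mul]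
  field_simp
  ring

lemma integral_comp_sq {f : ℝ → ℝ} (hm : 0 < m) (hmR : m ≤ R)
    (hf : ContinuousOn f (Set.Icc (m ^ 2) (R ^ 2))) :
    ∫ τ in (m ^ 2)..(R ^ 2), f τ = ∫ σ in m..R, f (σ ^ 2) * (2 * σ) := by
  symm
  refine intervalIntegral.integral_comp_mul_deriv'' (f := fun σ : ℝ => σ ^ 2) (by fun_prop)
    (fun σ _ => ?_) (by fun_prop) (hf.mono ?_)
  · simpa using (hasDerivAt_pow 2 σ).hasDerivWithinAt
  · rintro _ ⟨σ, hσ, rfl⟩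
    rw [Set.uIcc_of_le hmR] at hσ
    exact ⟨by nlinarith [hσ.1], by nlinarith [hσ.1, hσ.2]⟩

lemma young_bound {n γ p h : ℝ} (hn : 1 ≤ n) (hγ : γ ≤ 1 / 16) (hp : 0 ≤ p) (hh : 0 ≤ h) :
    (1 + γ) * (h * p) ≤ n * p ^ 2 + 1 / 2 * h ^ 2 := by
  have h1 : (1 + γ) * (h * p) ≤ 17 / 16 * (h * p) :=
    mul_le_mul_of_nonneg_right (by linarith) (mul_nonneg hh hp)
  have h2 : 1 * p ^ 2 ≤ n * p ^ 2 := mul_le_mul_of_nonneg_right hn (sq_nonneg p)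
  -- Completing the square leaves `(17/32)² h²`, and `(17/32)² < 1/2`.
  linarith [sq_nonneg (p - 17 / 32 * h), sq_nonneg h]

/-- For `l ≥ ε` the boundary term `n e^(-κl)/l^n` of `n φ` equals `l² k(l)/l`, where `k` is the
kernel, so only the value at `R` and the `κ` term of `integral_radialKernel` remain. The `κ` term
cancels the drift, the `P²` term absorbs `H P` by Young's inequality, and the leftover multiples of
`R H²`, namely `1/2`, `1/16` and `3/32`, are well below `9/4`. -/
lemma kernel_bound (hn : 1 ≤ n) {γ ε P Y H A : ℝ} (hγ : 0 ≤ γ) (hγn : 16 * n * γ ≤ 1) (hR : 0 < R)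
    (hε : 0 < ε) (hεR : ε < R / 2) (hl : 0 ≤ l) (hlR : l < R) (hY : |Y| ≤ l + |P|) (hA : 0 ≤ A)
    (hκ : κ = γ / (4 * R)) (hm : m = max l ε) :
    (∫ σ in m..R, radialKernel n κ σ) * (n + H * P - γ * (H * Y))
      - (if ε ≤ l then (l ^ 2 + P ^ 2) * radialKernel n κ l / l else 0)
      + (∫ σ in m..R, radialKernel n κ σ * ((σ ^ 2 - l ^ 2) / 2)) *
        (γ * (-γ * A + (2 * n + 1) * H ^ 2)) ≤
    n * ((if l < ε then (1 + 2 * |H * P|) / ε ^ n else 0) - Real.exp (-κ * R) / R ^ n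
      + 9 / 4 * R * H ^ 2 * (∫ σ in m..R, (σ ^ n)⁻¹)
      - (if l < R / 2 then γ ^ 2 * (5 / 128 * (R ^ 2 / R ^ n) * Real.exp (-κ * R)) * A else 0)) := by
  have hmε : ε ≤ m := hm ▸ le_max_right _ _
  have hlm : l ≤ m := hm ▸ le_max_left _ _
  have hm0 : 0 < m := hε.trans_le hmε
  have hmR : m ≤ R := hm ▸ max_le hlR.le (by linarith)
  have hκ0 : 0 ≤ κ := by rw [hκ]; positivity
  have hn' : (1 : ℝ) ≤ n := by exact_mod_cast hn
  have hγ1 : γ ≤ 1 / 16 := by nlinarith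
  have f1 := integral_radialKernel (n := n) (κ := κ) hm0 hmR
  have f1' := integral_radialKernel_le (n := n) hκ0 hm0 hmR
  have f0 := integral_radialKernel_nonneg (n := n) (κ := κ) hm0 hmR
  have f2 := mul_integral_radialKernel_le (n := n) (κ := κ) hm0 hmR hlm
  have f3 := integral_exp_div_pow_le (n := n) hκ0 hm0 hmR
  have f3' := integral_exp_div_pow_nonneg (n := n) (κ := κ) hm0 hmR
  have f4 := integral_radialKernel_second_nonneg (n := n) (κ := κ) hm0 hmR hl hlm
  have f5 := integral_radialKernel_second_le (n := n) (l := l) hκ0 hm0 hmR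
  have f6 : (if l < R / 2 then γ ^ 2 * (n * (5 / 128 * (R ^ 2 / R ^ n) * Real.exp (-κ * R))) * A
      else 0) ≤ γ ^ 2 * (∫ σ in m..R, radialKernel n κ σ * ((σ ^ 2 - l ^ 2) / 2)) * A := by
    split_ifs with h
    · have := le_integral_radialKernel_second (n := n) (κ := κ) hκ0 hR hm0
        (hm ▸ max_le h.le hεR.le) hl hlm
      gcongr
    · positivity
  set φ := ∫ σ in m..R, radialKernel n κ σ
  set J := ∫ σ in m..R, Real.exp (-κ * σ) / σ ^ n
  set J0 := ∫ σ in m..R, (σ ^ n)⁻¹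
  set Ψ := ∫ σ in m..R, radialKernel n κ σ * ((σ ^ 2 - l ^ 2) / 2)
  set eR := Real.exp (-κ * R) / R ^ n
  have hJ0 : 0 ≤ J0 := f3'.trans f3
  -- Here `l φ ≤ n J` and `|H| ≤ 1/(4R) + R H²`. The first summand contributes exactly `n κ J`,
  -- which dictates `κ = γ/(4R)`.
  have g1 : -(φ * (γ * (H * Y))) ≤ γ * φ * |H * P| + n * κ * J + γ * (n * R * H ^ 2 * J0) := by
    have h1 : -(H * Y) ≤ |H| * (l + |P|) := by
      calc -(H * Y) ≤ |H * Y| := neg_le_abs _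
        _ = |H| * |Y| := abs_mul _ _
        _ ≤ _ := by gcongr
    have h2 : |H| ≤ 1 / (4 * R) + R * H ^ 2 := by
      rw [← sq_abs H, div_add' _ _ _ (by positivity), le_div_iff₀ (by positivity)]
      nlinarith [sq_nonneg (2 * R * |H| - 1)]
    have h3 : |H| * (l * φ) ≤ n * J / (4 * R) + n * R * H ^ 2 * J0 := by
      calc |H| * (l * φ) ≤ |H| * (n * J) := by gcongr
        _ ≤ (1 / (4 * R) + R * H ^ 2) * (n * J) := by gcongr
        _ = n * J / (4 * R) + n * R * H ^ 2 * J := by ring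
        _ ≤ _ := by gcongr
    have h4 : n * κ * J = γ * (n * J / (4 * R)) := by rw [hκ]; ring
    rw [h4, abs_mul]
    have h5 : -(φ * (γ * (H * Y))) ≤ φ * γ * (|H| * (l + |P|)) := by
      have := mul_le_mul_of_nonneg_left h1 (mul_nonneg f0 hγ)
      linarith
    have h6 := mul_le_mul_of_nonneg_left h3 hγ
    linarith
  have g2 : φ * (H * P) ≤ φ * |H * P| := mul_le_mul_of_nonneg_left (le_abs_self _) f0
  have g3 : Ψ * (γ * ((2 * n + 1) * H ^ 2)) ≤ n * (3 / 32 * (R * H ^ 2 * J0)) := by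
    have h1 : γ * (2 * n + 1) ≤ 3 / 16 := by nlinarith
    have h2 : Ψ * (γ * ((2 * n + 1) * H ^ 2)) ≤ (n * R / 2 * J0) * (3 / 16 * H ^ 2) := by
      rw [← mul_assoc γ]
      gcongr
    linarith
  have g4 : γ * (n * R * H ^ 2 * J0) ≤ n * (1 / 16 * (R * H ^ 2 * J0)) := by
    have : 0 ≤ n * (R * H ^ 2 * J0) := by positivity
    nlinarith
  have f6' : n * (if l < R / 2 then γ ^ 2 * (5 / 128 * (R ^ 2 / R ^ n) * Real.exp (-κ * R)) * A
      else 0) ≤ γ ^ 2 * Ψ * A := by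
    refine le_trans (le_of_eq ?_) f6
    split_ifs
    · ring
    · ring
  have hpos : 0 ≤ n * (R * H ^ 2 * J0) := by positivity
  have e5 : φ * (n + H * P - γ * (H * Y)) =
      φ * n + φ * (H * P) + -(φ * (γ * (H * Y))) := by ring
  have e6 : Ψ * (γ * (-γ * A + (2 * n + 1) * H ^ 2)) =
      -(γ ^ 2 * Ψ * A) + Ψ * (γ * ((2 * n + 1) * H ^ 2)) := by ring
  clear_value φ J J0 Ψ eR
  -- Inside `l < ε` the kernel is cut off and no `P²` term is available; there everything is charged
  -- to the average over the small ball.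
  by_cases hle : ε ≤ l
  · have hml : m = l := by rw [hm, max_eq_left hle]
    have hl0 : 0 < l := hε.trans_le hle
    rw [if_pos hle, if_neg (not_lt.2 hle)]
    rw [hml] at f1 f1'
    have hk : radialKernel n κ l / l = n * (Real.exp (-κ * l) / l ^ n) / l ^ 2 := by
      unfold radialKernel
      field_simp
      ring
    set el := Real.exp (-κ * l) / l ^ n
    have e1 : (l ^ 2 + P ^ 2) * radialKernel n κ l / l = n * el + n * el * (P / l) ^ 2 := by
      rw [mul_div_assoc, hk]
      field_simp
    have e2 : (1 + γ) * φ * |H * P| ≤ n * el * (P / l) ^ 2 + n * (1 / 2 * (R * H ^ 2 * J0)) := by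
      have h1 : (1 + γ) * |H * P| ≤ n * (P / l) ^ 2 + 1 / 2 * H ^ 2 * l ^ 2 := by
        have h2 : |H * P| = (|H| * l) * |P / l| := by
          rw [abs_mul, abs_div, abs_of_pos hl0]
          field_simp
        have h4 := young_bound hn' hγ1 (abs_nonneg (P / l)) (mul_nonneg (abs_nonneg H) hl0.le)
        rw [sq_abs, mul_pow, sq_abs] at h4
        rw [h2]
        linarith
      have h3 : φ * l ^ 2 ≤ n * (R * J0) := by
        have : φ * l ^ 2 ≤ l * (n * J0) :=
          calc φ * l ^ 2 = l * (l * φ) := by ring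
            _ ≤ l * (n * J) := by gcongr
            _ ≤ _ := by gcongr
        have : l * (n * J0) ≤ R * (n * J0) := by gcongr
        linarith
      calc (1 + γ) * φ * |H * P| = φ * ((1 + γ) * |H * P|) := by ring
        _ ≤ φ * (n * (P / l) ^ 2 + 1 / 2 * H ^ 2 * l ^ 2) := by gcongr
        _ = n * φ * (P / l) ^ 2 + 1 / 2 * H ^ 2 * (φ * l ^ 2) := by ring
        _ ≤ n * el * (P / l) ^ 2 + 1 / 2 * H ^ 2 * (n * (R * J0)) := by
          have hφel : φ ≤ el := by linarith
          gcongr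
        _ = _ := by ring
    rw [e1, e5, e6]
    have e4 : φ * n = n * el - n * eR - n * κ * J := by rw [f1]; ring
    linarith
  · have hml : m = ε := by rw [hm, max_eq_right (not_le.1 hle).le]
    rw [if_neg hle, if_pos (not_le.1 hle)]
    rw [hml] at f1 f1'
    have he : Real.exp (-κ * ε) / ε ^ n ≤ 1 / ε ^ n := by
      gcongr
      exact exp_neg_mul_le_one hκ0 hε.le
    have e1 : (1 + 2 * |H * P|) / ε ^ n = 1 / ε ^ n + 2 * (1 / ε ^ n) * |H * P| := by ring
    have e2 : (1 + γ) * φ * |H * P| ≤ n * (2 * (1 / ε ^ n) * |H * P|) := by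
      have h1 : (1 + γ) * φ ≤ 2 * (1 / ε ^ n) := by
        have : φ ≤ 1 / ε ^ n := f1'.trans he
        calc (1 + γ) * φ ≤ 2 * φ := mul_le_mul_of_nonneg_right (by linarith) f0
          _ ≤ _ := by linarith
      have h2 : 0 ≤ 2 * (1 / ε ^ n) * |H * P| := by positivity
      have h3 := mul_le_mul_of_nonneg_right h1 (abs_nonneg (H * P))
      exact h3.trans (le_mul_of_one_le_left h2 hn')
    have e4 : φ * n ≤ n * (1 / ε ^ n) - n * eR - n * κ * J := by
      have : n * (Real.exp (-κ * ε) / ε ^ n) ≤ n * (1 / ε ^ n) := by gcongr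
      calc φ * n = n * (Real.exp (-κ * ε) / ε ^ n) - n * eR - n * κ * J := by
            rw [f1]; ring
        _ ≤ _ := by linarith
    rw [e1, e5, e6]
    linarith

end RadialKernel

/-! ### The kernel as a function of the squared distance -/

section KernelEvaluation

variable {l ε R : ℝ}

lemma integral_indicator_Ico {f : ℝ → ℝ} (hε : 0 < ε) (hl : 0 ≤ l) (hlR : l ≤ R) (hεR : ε ≤ R) :
    ∫ τ in (l ^ 2)..(R ^ 2), (Set.Ico (ε ^ 2) (R ^ 2)).indicator f τ =
      ∫ τ in ((max l ε) ^ 2)..(R ^ 2), f τ := by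
  have h1 : l ^ 2 ≤ R ^ 2 := by gcongr
  have h2 : (max l ε) ^ 2 ≤ R ^ 2 := by
    have : max l ε ≤ R := max_le hlR hεR
    gcongr
  rw [intervalIntegral.integral_of_le h1, intervalIntegral.integral_of_le h2,
    setIntegral_indicator measurableSet_Ico]
  apply setIntegral_congr_set
  have hset : (Set.Ioc (l ^ 2) (R ^ 2) ∩ Set.Ico (ε ^ 2) (R ^ 2) : Set ℝ) =ᵐ[volume]
      (Set.Ioo (l ^ 2) (R ^ 2) ∩ Set.Ioo (ε ^ 2) (R ^ 2) : Set ℝ) :=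
    Ioo_ae_eq_Ioc.symm.inter Ioo_ae_eq_Ico.symm
  refine hset.trans ?_
  rw [Set.Ioo_inter_Ioo, min_self]
  have : l ^ 2 ⊔ ε ^ 2 = (max l ε) ^ 2 := by
    rcases le_total l ε with h | h
    · rw [max_eq_right h, max_eq_right (by gcongr)]
    · rw [max_eq_left h, max_eq_left (by gcongr)]
  rw [this]
  exact Ioo_ae_eq_Ioc

/-- The radial kernel in terms of the squared distance, made constant below `ε²`. -/
def sqKernel (n : ℕ) (κ ε τ : ℝ) : ℝ :=
  radialKernel n κ (Real.sqrt (max τ (ε ^ 2))) / (2 * Real.sqrt (max τ (ε ^ 2)))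

/-- The integral identity wants a density continuous on all of `ℝ`. Freezing it below `ε²` provides
this and changes nothing, as the indicator of `[ε², R²)` removes that range. -/
lemma continuous_sqKernel (n : ℕ) (κ : ℝ) (hε : 0 < ε) : Continuous (sqKernel n κ ε) := by
  have hpos : ∀ τ : ℝ, 0 < Real.sqrt (max τ (ε ^ 2)) := fun τ =>
    Real.sqrt_pos.2 (lt_max_of_lt_right (by positivity))
  have hc : Continuous fun τ : ℝ => Real.sqrt (max τ (ε ^ 2)) := by fun_prop
  refine Continuous.div ?_ (by fun_prop) fun τ => (mul_pos two_pos (hpos τ)).ne'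
  exact continuousOn_radialKernel.comp_continuous hc hpos

lemma sqKernel_sq (n : ℕ) (κ : ℝ) {σ : ℝ} (hε : 0 < ε) (hσ : ε ≤ σ) :
    sqKernel n κ ε (σ ^ 2) = radialKernel n κ σ / (2 * σ) := by
  rw [sqKernel, max_eq_left (by gcongr), Real.sqrt_sq (hε.le.trans hσ)]

lemma integral_sqKernel_mul (n : ℕ) (κ : ℝ) {w : ℝ → ℝ} (hw : Continuous w) (hε : 0 < ε)
    (hl : 0 ≤ l) (hlR : l ≤ R) (hεR : ε ≤ R) :
    ∫ τ in (l ^ 2)..(R ^ 2), (Set.Ico (ε ^ 2) (R ^ 2)).indicator (sqKernel n κ ε) τ * w τ =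
      ∫ σ in (max l ε)..R, radialKernel n κ σ * w (σ ^ 2) := by
  simp_rw [← Set.indicator_mul_left]
  have hm : 0 < max l ε := lt_max_of_lt_right hε
  rw [integral_indicator_Ico hε hl hlR hεR, integral_comp_sq
    (f := fun τ => sqKernel n κ ε τ * w τ) hm (max_le hlR hεR)
    ((continuous_sqKernel n κ hε).mul hw).continuousOn]
  refine intervalIntegral.integral_congr fun σ hσ => ?_
  rw [Set.uIcc_of_le (max_le hlR hεR)] at hσ
  have hσε : ε ≤ σ := (le_max_right _ _).trans hσ.1
  have hσ0 : 0 < σ := hε.trans_le hσε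
  simp only [sqKernel_sq n κ hε hσε]
  field_simp

end KernelEvaluation

/-! ### Exchange of the radial and the spatial integral -/

section LayerCake

variable {u : E N → ℝ} {x₀ : E N} {ε R : ℝ}

/-- Fubini on the set of pairs `(x, σ)` with `l(x) < σ`. It turns a pointwise kernel into integrals
over the balls `K_σ`, where the density ratio can enter. -/
lemma layer_cake (hu : Continuous u) (h0 : Tendsto u (cocompact (E N)) (𝓝 0)) (hε : 0 < ε)
    (hεR : ε ≤ R) {f : E N → ℝ} (hf : Continuous f) (n : ℕ) :
    IntegrableOn (fun x => f x *
      ∫ σ in (max (Real.sqrt (lorentzSq u x₀ x)) ε)..R, (σ ^ n)⁻¹) (K u R x₀) ∧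
    IntervalIntegrable (fun σ => (σ ^ n)⁻¹ * ∫ x in K u σ x₀, f x) volume ε R ∧
    ∫ x in K u R x₀, f x * (∫ σ in (max (Real.sqrt (lorentzSq u x₀ x)) ε)..R, (σ ^ n)⁻¹) =
      ∫ σ in ε..R, (σ ^ n)⁻¹ * ∫ x in K u σ x₀, f x := by
  have hR : 0 < R := hε.trans_le hεR
  have hKR := measurableSet_K (x₀ := x₀) hu R
  set S : Set (E N × ℝ) := {p | Real.sqrt (lorentzSq u x₀ p.1) < p.2} with hS
  have hSm : MeasurableSet S := by
    have := continuous_lorentzSq (x₀ := x₀) hu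
    exact (isOpen_lt (f := fun p : E N × ℝ => Real.sqrt (lorentzSq u x₀ p.1)) (g := fun p => p.2)
      (by fun_prop) (by fun_prop)).measurableSet
  set F : E N × ℝ → ℝ := S.indicator fun p => f p.1 * (p.2 ^ n)⁻¹ with hF
  have hFi : Integrable F ((volume.restrict (K u R x₀)).prod (volume.restrict (Set.Ioc ε R))) := by
    refine Integrable.indicator ?_ hSm
    refine Integrable.mul_prod (f := f) (g := fun σ => (σ ^ n)⁻¹) (integrableOn_K hu h0 hR hf) ?_
    have := intervalIntegrable_of_continuousOn_Ioi (continuousOn_inv_pow (n := n)) hε hεR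
    rwa [intervalIntegrable_iff_integrableOn_Ioc_of_le hεR] at this
  have h1 : ∀ x ∈ K u R x₀, ∫ σ in Set.Ioc ε R, F (x, σ) =
      f x * ∫ σ in (max (Real.sqrt (lorentzSq u x₀ x)) ε)..R, (σ ^ n)⁻¹ := by
    intro x hx
    have hx' : Real.sqrt (lorentzSq u x₀ x) < R := hx
    rw [intervalIntegral.integral_of_le (max_le hx'.le hεR), ← integral_const_mul]
    have : (fun σ => F (x, σ)) = (Set.Ioi (Real.sqrt (lorentzSq u x₀ x))).indicator
        fun σ => f x * (σ ^ n)⁻¹ := by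
      ext σ
      simp only [hF, Set.indicator]
      rfl
    rw [this, setIntegral_indicator measurableSet_Ioi, Set.Ioc_inter_Ioi, max_comm]
  have h2 : ∀ σ ∈ Set.Ioc ε R, ∫ x in K u R x₀, F (x, σ) =
      (σ ^ n)⁻¹ * ∫ x in K u σ x₀, f x := by
    intro σ hσ
    rw [← integral_const_mul]
    have : (fun x => F (x, σ)) = (K u σ x₀).indicator fun x => (σ ^ n)⁻¹ * f x := by
      ext x
      simp only [hF, Set.indicator, mul_comm]
      rfl
    rw [this, setIntegral_indicator (measurableSet_K hu σ), Set.inter_eq_right.2]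
    intro x hx
    exact lt_of_lt_of_le (show lorentzDist u x x₀ < σ from hx) hσ.2
  refine ⟨?_, ?_, ?_⟩
  · exact (hFi.integral_prod_left).congr ((ae_restrict_mem hKR).mono h1)
  · rw [intervalIntegrable_iff_integrableOn_Ioc_of_le hεR]
    exact (hFi.integral_prod_right).congr ((ae_restrict_mem measurableSet_Ioc).mono h2)
  · rw [intervalIntegral.integral_of_le hεR, ← setIntegral_congr_fun hKR h1,
      ← setIntegral_congr_fun measurableSet_Ioc h2]
    exact integral_integral_swap hFi

end LayerCake

/-! ### The estimate with a small ball removed -/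

section LocalEstimate

variable {u : E N → ℝ} {x₀ : E N} {γ ε R : ℝ}

lemma coeff_le (hu : ContDiff ℝ 3 u) (hs : StrictlySpacelike u) (hN : 1 ≤ N) (hγ : 0 ≤ γ)
    (hγN : 16 * N * γ ≤ 1) (hR : 0 < R) (hε : 0 < ε) (hεR : ε < R / 2) {x : E N}
    (hx : x ∈ K u R x₀) :
    kernelFirst ((Set.Ico (ε ^ 2) (R ^ 2)).indicator (sqKernel N (γ / (4 * R)) ε)) (R ^ 2)
        (lorentzSq u x₀ x) * coeffFirst γ u x₀ x
      - (Set.Ico (ε ^ 2) (R ^ 2)).indicator (sqKernel N (γ / (4 * R)) ε) (lorentzSq u x₀ x)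
        * coeffDeriv γ u x₀ x
      + kernelSecond ((Set.Ico (ε ^ 2) (R ^ 2)).indicator (sqKernel N (γ / (4 * R)) ε)) (R ^ 2)
        (lorentzSq u x₀ x) * coeffSecond γ u x ≤
    N * ((K u ε x₀).indicator (fun x => v u x ^ (γ + 1) *
          (1 + 2 * |meanCurv u x * normalPart u x₀ x|)) x / ε ^ N
      - Real.exp (-γ / 4) / R ^ N * v u x ^ (γ + 1)
      + 9 / 4 * R * ((v u x ^ (γ + 1) * meanCurv u x ^ 2) *
        ∫ σ in (max (Real.sqrt (lorentzSq u x₀ x)) ε)..R, (σ ^ N)⁻¹)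
      - γ ^ 2 * (5 / 128 * (R ^ 2 / R ^ N) * Real.exp (-γ / 4)) *
        (K u (R / 2) x₀).indicator (fun x => v u x ^ (γ + 1) * secondFormSq u x) x) := by
  have hg := hs.norm_gradient_lt
  set κ := γ / (4 * R) with hκ
  have hκR : -κ * R = -γ / 4 := by
    rw [hκ]
    field_simp
  set l := Real.sqrt (lorentzSq u x₀ x) with hl
  have hl0 : 0 ≤ l := Real.sqrt_nonneg _
  have hlR : l < R := hx
  have hL : lorentzSq u x₀ x = l ^ 2 := (Real.sq_sqrt (lorentzSq_nonneg hs)).symm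
  set χ := (Set.Ico (ε ^ 2) (R ^ 2)).indicator (sqKernel N κ ε) with hχ
  have e1 : kernelFirst χ (R ^ 2) (l ^ 2) = ∫ σ in (max l ε)..R, radialKernel N κ σ := by
    have := integral_sqKernel_mul N κ (w := fun _ => 1) continuous_const hε hl0 hlR.le
      (by linarith)
    simpa [kernelFirst, hχ] using this
  have e2 : kernelSecond χ (R ^ 2) (l ^ 2) =
      ∫ σ in (max l ε)..R, radialKernel N κ σ * ((σ ^ 2 - l ^ 2) / 2) :=
    integral_sqKernel_mul N κ (w := fun τ => (τ - l ^ 2) / 2) (by fun_prop) hε hl0 hlR.le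
      (by linarith)
  have e3 : χ (l ^ 2) * coeffDeriv γ u x₀ x = v u x ^ (γ + 1) *
      (if ε ≤ l then (l ^ 2 + normalPart u x₀ x ^ 2) * radialKernel N κ l / l else 0) := by
    split_ifs with h
    · have hl1 : 0 < l := hε.trans_le h
      rw [hχ, Set.indicator_of_mem (show l ^ 2 ∈ Set.Ico (ε ^ 2) (R ^ 2) from
        ⟨by gcongr, by gcongr⟩), sqKernel_sq N κ hε h, coeffDeriv, hL]
      field_simp
    · have h' : l ^ 2 < ε ^ 2 := by
        have := not_le.1 h
        gcongr
      rw [hχ, Set.indicator_of_notMem (fun hm : l ^ 2 ∈ Set.Ico (ε ^ 2) (R ^ 2) =>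
        absurd hm.1 (not_le.2 h'))]
      simp
  -- Nonnegativity of `Ψ` is what permits inserting the upper bound for `coeffSecond`.
  have hΨ0 : 0 ≤ ∫ σ in (max l ε)..R, radialKernel N κ σ * ((σ ^ 2 - l ^ 2) / 2) :=
    integral_radialKernel_second_nonneg (lt_max_of_lt_right hε)
      (max_le hlR.le (by linarith)) hl0 (le_max_left _ _)
  have hb := kernel_bound (n := N) (κ := κ) (l := l) (H := meanCurv u x) hN hγ hγN hR hε hεR hl0 hlR
    (abs_normalPart_add_le (x₀ := x₀) (hg x)) (secondFormSq_nonneg (u := u) (x := x)) hκ rfl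
  rw [hκR] at hb
  have hg0 : 0 ≤ v u x ^ (γ + 1) := Real.rpow_nonneg (v_pos (hg x)).le _
  have hb' := mul_le_mul_of_nonneg_left hb hg0
  have hc := mul_le_mul_of_nonneg_left (coeffSecond_le hu hg hN hγ hγN (x := x)) hΨ0
  have i1 : (K u ε x₀).indicator (fun x => v u x ^ (γ + 1) *
      (1 + 2 * |meanCurv u x * normalPart u x₀ x|)) x / ε ^ N = v u x ^ (γ + 1) *
      (if l < ε then (1 + 2 * |meanCurv u x * normalPart u x₀ x|) / ε ^ N else 0) := by
    by_cases h : l < ε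
    · rw [if_pos h, Set.indicator_of_mem (show x ∈ K u ε x₀ from h)]
      ring
    · rw [if_neg h, Set.indicator_of_notMem (show x ∉ K u ε x₀ from h)]
      ring
  have i2 : γ ^ 2 * (5 / 128 * (R ^ 2 / R ^ N) * Real.exp (-γ / 4)) *
      (K u (R / 2) x₀).indicator (fun x => v u x ^ (γ + 1) * secondFormSq u x) x =
      v u x ^ (γ + 1) * (if l < R / 2 then
        γ ^ 2 * (5 / 128 * (R ^ 2 / R ^ N) * Real.exp (-γ / 4)) * secondFormSq u x else 0) := by
    by_cases h : l < R / 2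
    · rw [if_pos h, Set.indicator_of_mem (show x ∈ K u (R / 2) x₀ from h)]
      ring
    · rw [if_neg h, Set.indicator_of_notMem (show x ∉ K u (R / 2) x₀ from h)]
      ring
  rw [hL, e1, e2, e3, i1, i2, coeffFirst]
  linarith

lemma zero_le_of_integral_combination {α : Type*} [MeasurableSpace α] {μ : Measure α} {S : Set α}
    (hS : MeasurableSet S) {X f₁ f₂ f₃ f₄ : α → ℝ} {c : ℝ} (hX : IntegrableOn X S μ)
    (hX0 : ∫ x in S, X x ∂μ = 0) (h₁ : IntegrableOn f₁ S μ) (h₂ : IntegrableOn f₂ S μ)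
    (h₃ : IntegrableOn f₃ S μ) (h₄ : IntegrableOn f₄ S μ) (hc : 0 < c)
    (h : ∀ x ∈ S, X x ≤ c * (f₁ x - f₂ x + f₃ x - f₄ x)) :
    0 ≤ (∫ x in S, f₁ x ∂μ) - (∫ x in S, f₂ x ∂μ) + (∫ x in S, f₃ x ∂μ)
      - ∫ x in S, f₄ x ∂μ := by
  have h5 : IntegrableOn (fun x => f₁ x - f₂ x + f₃ x - f₄ x) S μ := ((h₁.sub h₂).add h₃).sub h₄
  have hle := setIntegral_mono_on hX (h5.const_mul c) hS h
  rw [hX0, integral_const_mul] at hle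
  have h6 := nonneg_of_mul_nonneg_right hle hc
  have h7 : IntegrableOn (fun x => f₁ x - f₂ x) S μ := h₁.sub h₂
  have h8 : IntegrableOn (fun x => f₁ x - f₂ x + f₃ x) S μ := h7.add h₃
  rwa [integral_sub h8 h₄, integral_add h7 h₃, integral_sub h₁ h₂] at h6

lemma local_estimate (hu : ContDiff ℝ 3 u) (hs : StrictlySpacelike u)
    (h0 : Tendsto u (cocompact (E N)) (𝓝 0)) (hN : 1 ≤ N) (hγ : 0 ≤ γ)
    (hγN : 16 * N * γ ≤ 1) (hR : 0 < R) (hε : 0 < ε) (hεR : ε < R / 2) :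
    Real.exp (-γ / 4) / R ^ N * (∫ x in K u R x₀, v u x ^ (γ + 1))
      + γ ^ 2 * (5 / 128 * (R ^ 2 / R ^ N) * Real.exp (-γ / 4)) *
        (∫ x in K u (R / 2) x₀, v u x ^ (γ + 1) * secondFormSq u x) ≤
    (∫ x in K u ε x₀, v u x ^ (γ + 1) * (1 + 2 * |meanCurv u x * normalPart u x₀ x|)) / ε ^ N
      + 9 / 4 * R * ∫ σ in ε..R, (σ ^ N)⁻¹ *
        ∫ x in K u σ x₀, v u x ^ (γ + 1) * meanCurv u x ^ 2 := by
  have hg := hs.norm_gradient_lt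
  have c1 := (contDiff_v_rpow hu hg (γ + 1)).continuous
  have c2 := (contDiff_meanCurv hu hg).continuous
  have c3 := continuous_normalPart (x₀ := x₀) hu hg
  have c4 := continuous_secondFormSq hu hg
  obtain ⟨j1, -, j3⟩ := layer_cake (x₀ := x₀) (R := R) hu.continuous h0 hε (by linarith)
    (f := fun x => v u x ^ (γ + 1) * meanCurv u x ^ 2) (c1.mul (c2.pow 2)) N
  have hKR := measurableSet_K (x₀ := x₀) hu.continuous R
  have hsub : ∀ r, r ≤ R → K u R x₀ ∩ K u r x₀ = K u r x₀ := fun r hr =>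
    Set.inter_eq_right.2 fun x hx => lt_of_lt_of_le (show lorentzDist u x x₀ < r from hx) hr
  have k1 : IntegrableOn (fun x => (K u ε x₀).indicator (fun x => v u x ^ (γ + 1) *
      (1 + 2 * |meanCurv u x * normalPart u x₀ x|)) x / ε ^ N) (K u R x₀) := by
    refine Integrable.div_const ?_ _
    refine Integrable.indicator ?_ (measurableSet_K hu.continuous ε)
    exact integrableOn_K hu.continuous h0 hR (by fun_prop)
  have k2 : IntegrableOn (fun x => Real.exp (-γ / 4) / R ^ N * v u x ^ (γ + 1)) (K u R x₀) :=
    integrableOn_K hu.continuous h0 hR (by fun_prop)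
  have k3 := Integrable.const_mul j1 (9 / 4 * R)
  have k4 : IntegrableOn (fun x => γ ^ 2 * (5 / 128 * (R ^ 2 / R ^ N) * Real.exp (-γ / 4)) *
        (K u (R / 2) x₀).indicator (fun x => v u x ^ (γ + 1) * secondFormSq u x) x)
        (K u R x₀) := by
    refine Integrable.const_mul ?_ _
    refine Integrable.indicator ?_ (measurableSet_K hu.continuous _)
    exact integrableOn_K hu.continuous h0 hR (by fun_prop)
  set X : E N → ℝ := fun x =>
    kernelFirst ((Set.Ico (ε ^ 2) (R ^ 2)).indicator (sqKernel N (γ / (4 * R)) ε)) (R ^ 2)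
        (lorentzSq u x₀ x) * coeffFirst γ u x₀ x
      - (Set.Ico (ε ^ 2) (R ^ 2)).indicator (sqKernel N (γ / (4 * R)) ε) (lorentzSq u x₀ x)
        * coeffDeriv γ u x₀ x
      + kernelSecond ((Set.Ico (ε ^ 2) (R ^ 2)).indicator (sqKernel N (γ / (4 * R)) ε)) (R ^ 2)
        (lorentzSq u x₀ x) * coeffSecond γ u x with hX
  obtain ⟨hXi, hXint⟩ : Integrable X ∧ ∫ x, X x = 0 :=
    integral_kernel_eq_zero hu hs h0 γ (continuous_sqKernel N _ hε) (ε ^ 2) (pow_pos hR 2)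
  have hXout : ∀ x, x ∉ K u R x₀ → X x = 0 := by
    intro x hx
    have hx' : R ^ 2 ≤ lorentzSq u x₀ x := not_lt.1 fun h => hx ((mem_K_iff hR).2 h)
    have hi : ∀ t, R ^ 2 ≤ t →
        (Set.Ico (ε ^ 2) (R ^ 2)).indicator (sqKernel N (γ / (4 * R)) ε) t = 0 := fun t ht =>
      Set.indicator_of_notMem (fun h' : t ∈ Set.Ico (ε ^ 2) (R ^ 2) =>
        absurd h'.2 (not_lt.2 ht)) _
    simp only [hX]
    rw [kernelFirst_eq_zero hi hx', kernelSecond_eq_zero hi hx', hi _ hx']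
    ring
  have hXK : ∫ x in K u R x₀, X x = 0 := by
    rw [setIntegral_eq_integral_of_forall_compl_eq_zero hXout, hXint]
  have hle := zero_le_of_integral_combination hKR hXi.integrableOn hXK k1 k2 k3 k4 (Nat.cast_pos.2 hN)
    fun x hx => coeff_le hu hs hN hγ hγN hR hε hεR hx
  rw [integral_div, integral_const_mul, integral_const_mul, integral_const_mul, j3,
    setIntegral_indicator (measurableSet_K hu.continuous _),
    setIntegral_indicator (measurableSet_K hu.continuous _), hsub _ (by linarith),
    hsub _ (by linarith)] at hle
  linarith

end LocalEstimate

/-! ### Volume of the infinitesimal Lorentz ball -/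

section Ellipsoid

lemma omega_pos (N : ℕ) : 0 < omega N :=
  ENNReal.toReal_pos (Metric.measure_ball_pos _ _ one_pos).ne' measure_ball_lt_top.ne

lemma exists_linearMap_lorentz (a : E N) (ha : ‖a‖ < 1) :
    ∃ T : E N →ₗ[ℝ] E N, LinearMap.det T = (Real.sqrt (1 - ‖a‖ ^ 2))⁻¹ ∧
      ∀ y, ‖T y‖ ^ 2 - inner ℝ a (T y) ^ 2 = ‖y‖ ^ 2 := by
  set w := Real.sqrt (1 - ‖a‖ ^ 2) with hw
  have hpos : 0 < 1 - ‖a‖ ^ 2 := by nlinarith [norm_nonneg a]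
  have hw0 : 0 < w := Real.sqrt_pos.2 hpos
  have hw2 : w ^ 2 = 1 - ‖a‖ ^ 2 := Real.sq_sqrt hpos.le
  have ha2 : ‖a‖ ^ 2 = 1 - w ^ 2 := by linarith
  -- The map `y ↦ y + c ⟨a, y⟩ a` fixes the orthogonal complement of `a`. This `c` makes it stretch
  -- `a` by `1 + c|a|² = 1/w`.
  set c := (w * (1 + w))⁻¹ with hc
  refine ⟨LinearMap.transvection (innerSL ℝ a).toLinearMap (c • a), ?_, fun y => ?_⟩
  · rw [LinearMap.transvection.det]
    simp only [ContinuousLinearMap.coe_coe, innerSL_apply_apply, inner_smul_right,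
      real_inner_self_eq_norm_sq]
    rw [ha2, hc]
    field_simp
    ring
  · have hT : LinearMap.transvection (innerSL ℝ a).toLinearMap (c • a) y =
        y + (inner ℝ a y * c) • a := by
      simp [LinearMap.transvection, smul_smul]
    rw [hT, ← real_inner_self_eq_norm_sq, inner_add_right, inner_add_left, inner_add_left,
      inner_add_right]
    simp only [inner_smul_left, inner_smul_right, real_inner_self_eq_norm_sq, ha2,
      real_inner_comm y a, conj_trivial]
    rw [real_inner_comm, hc]
    field_simp
    ring

lemma volume_lorentz_ball (a : E N) (ha : ‖a‖ < 1) :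
    (volume {y : E N | ‖y‖ ^ 2 - inner ℝ a y ^ 2 < 1}).toReal =
      omega N / Real.sqrt (1 - ‖a‖ ^ 2) := by
  obtain ⟨T, hdet, hT⟩ := exists_linearMap_lorentz a ha
  have hw : 0 < Real.sqrt (1 - ‖a‖ ^ 2) :=
    Real.sqrt_pos.2 (by nlinarith [norm_nonneg a])
  have h := Measure.addHaar_preimage_linearMap volume (f := T)
    (by rw [hdet]; exact (inv_pos.2 hw).ne') {y : E N | ‖y‖ ^ 2 - inner ℝ a y ^ 2 < 1}
  have hpre : T ⁻¹' {y : E N | ‖y‖ ^ 2 - inner ℝ a y ^ 2 < 1} = Metric.ball 0 1 := by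
    ext y
    rw [Set.mem_preimage, Set.mem_ofPred_eq, hT, mem_ball_zero_iff, sq_lt_one_iff₀ (norm_nonneg _)]
  rw [hpre, hdet, inv_inv, abs_of_pos hw] at h
  rw [omega, h, ENNReal.toReal_mul, ENNReal.toReal_ofReal hw.le, mul_div_cancel_left₀ _ hw.ne']

lemma volume_lorentz_sphere (a : E N) (ha : ‖a‖ < 1) :
    volume {y : E N | ‖y‖ ^ 2 - inner ℝ a y ^ 2 = 1} = 0 := by
  obtain ⟨T, hdet, hT⟩ := exists_linearMap_lorentz a ha
  have hw : 0 < Real.sqrt (1 - ‖a‖ ^ 2) :=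
    Real.sqrt_pos.2 (by nlinarith [norm_nonneg a])
  have h := Measure.addHaar_preimage_linearMap volume (f := T)
    (by rw [hdet]; exact (inv_pos.2 hw).ne') {y : E N | ‖y‖ ^ 2 - inner ℝ a y ^ 2 = 1}
  have hpre : T ⁻¹' {y : E N | ‖y‖ ^ 2 - inner ℝ a y ^ 2 = 1} = Metric.sphere 0 1 := by
    ext y
    rw [Set.mem_preimage, Set.mem_ofPred_eq, hT, mem_sphere_zero_iff_norm]
    constructor
    · intro h
      nlinarith [norm_nonneg y]
    · intro h
      rw [h, one_pow]
  rw [hpre, hdet, inv_inv, abs_of_pos hw, Measure.addHaar_sphere_of_ne_zero _ _ one_ne_zero] at h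
  rcases mul_eq_zero.1 h.symm with h | h
  · exact absurd (ENNReal.ofReal_eq_zero.1 h) (not_le.2 hw)
  · exact h

end Ellipsoid

/-! ### Averages over shrinking Lorentz balls -/

section Density

variable {u : E N → ℝ} {x₀ : E N}

/-- On the compact set where `l² ≤ 1` and `|x - x₀| ≥ δ`, strict spacelikeness gives `l²` a positive
minimum. Thus small Lorentz balls are small in the Euclidean sense, although their points are not
assumed near `x₀`. -/
lemma exists_lorentz_lower_bound (hs : StrictlySpacelike u)
    (h0 : Tendsto u (cocompact (E N)) (𝓝 0)) {δ : ℝ} (hδ : 0 < δ) :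
    ∃ e > 0, ∀ x ∈ K u e x₀, ‖x - x₀‖ < δ := by
  have hu := hs.contDiff.continuous
  set S := {x | lorentzSq u x₀ x ≤ 1} ∩ {x | δ ≤ ‖x - x₀‖} with hS
  have hSc : IsCompact S := (isCompact_lorentzSq_le hu h0 1).inter_right
    (isClosed_le continuous_const (by fun_prop))
  rcases S.eq_empty_or_nonempty with hE | hne
  · refine ⟨1, one_pos, fun x hx => ?_⟩
    by_contra hcon
    have : x ∈ S := ⟨by simpa using ((mem_K_iff one_pos).1 hx).le, not_lt.1 hcon⟩
    rw [hE] at this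
    exact this
  · obtain ⟨z, hz, hmin⟩ := hSc.exists_isMinOn hne (continuous_lorentzSq (x₀ := x₀) hu).continuousOn
    have hz0 : z ≠ x₀ := by
      rintro rfl
      have := hz.2
      simp only [Set.mem_ofPred_eq, sub_self, norm_zero] at this
      linarith
    have hzpos := lorentzSq_pos hs hz0
    have hmpos : 0 < min 1 (lorentzSq u x₀ z) := lt_min one_pos hzpos
    refine ⟨Real.sqrt (min 1 (lorentzSq u x₀ z)), Real.sqrt_pos.2 hmpos, fun x hx => ?_⟩
    rw [mem_K_iff (Real.sqrt_pos.2 hmpos), Real.sq_sqrt hmpos.le, lt_min_iff] at hx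
    by_contra hcon
    have : x ∈ S := ⟨hx.1.le, not_lt.1 hcon⟩
    exact absurd (hmin this) (not_le.2 hx.2)

lemma fderiv_eq_inner_gradient (x w : E N) :
    fderiv ℝ u x w = inner ℝ (gradient u x) w := by
  rw [← InnerProductSpace.toDual_apply_apply, toDual_gradient]

/-- Under `x = x₀ + ε y` the ball becomes `|y|² - ((u(x₀ + εy) - u(x₀))/ε)² < 1`, and
differentiability of `u` at `x₀` gives convergence of the indicators off the bounding quadric, a
null set. -/
lemma tendsto_integral_K_div (hs : StrictlySpacelike u)
    (h0 : Tendsto u (cocompact (E N)) (𝓝 0)) {G : E N → ℝ} (hG : Continuous G) :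
    Tendsto (fun ε => (∫ x in K u ε x₀, G x) / ε ^ N) (𝓝[>] 0) (𝓝 (omega N * G x₀ / v u x₀)) := by
  have hu := hs.contDiff.continuous
  have hud : Differentiable ℝ u := hs.contDiff.differentiable (by simp)
  set a := gradient u x₀ with ha
  have ha1 : ‖a‖ < 1 := hs.norm_gradient_lt x₀
  have hfd : HasFDerivAt u (fderiv ℝ u x₀) x₀ := (hud x₀).hasFDerivAt
  -- A slope strictly between `|∇u(x₀)|` and 1 bounds the increments of `u` from `x₀` nearby. It
  -- confines the rescaled balls to radius `(1 - θ²)^(-1/2)`, which supplies the dominating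
  -- function.
  set θ := (1 + ‖a‖) / 2 with hθ
  have hθ1 : θ < 1 := by rw [hθ]; linarith
  have hθ0 : 0 < θ := by rw [hθ]; linarith [norm_nonneg a]
  obtain ⟨δ, hδ, hlip⟩ : ∃ δ > 0, ∀ x, ‖x - x₀‖ < δ → |u x - u x₀| ≤ θ * ‖x - x₀‖ := by
    have h1 := hfd.isLittleO.def (c := (1 - ‖a‖) / 2) (by linarith)
    obtain ⟨δ, hδ, h2⟩ := Metric.eventually_nhds_iff.1 h1
    refine ⟨δ, hδ, fun x hx => ?_⟩
    have h3 := h2 (by rwa [dist_eq_norm] : dist x x₀ < δ)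
    have h4 : |fderiv ℝ u x₀ (x - x₀)| ≤ ‖a‖ * ‖x - x₀‖ := by
      rw [fderiv_eq_inner_gradient]
      exact abs_real_inner_le_norm _ _
    rw [Real.norm_eq_abs] at h3
    have h5 := abs_add_le (u x - u x₀ - fderiv ℝ u x₀ (x - x₀)) (fderiv ℝ u x₀ (x - x₀))
    rw [sub_add_cancel] at h5
    rw [hθ]
    linarith
  obtain ⟨e, he, hKe⟩ := exists_lorentz_lower_bound (x₀ := x₀) hs h0 hδ
  set C := (Real.sqrt (1 - θ ^ 2))⁻¹ with hC
  have hθ2 : 0 < 1 - θ ^ 2 := by nlinarith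
  obtain ⟨M, hM⟩ := (isCompact_closedBall x₀ δ).exists_bound_of_continuousOn hG.continuousOn
  have hmem : ∀ {ε : ℝ} (hε : 0 < ε) (y : E N), x₀ + ε • y ∈ K u ε x₀ ↔
      ‖y‖ ^ 2 - ((u (x₀ + ε • y) - u x₀) / ε) ^ 2 < 1 := by
    intro ε hε y
    rw [mem_K_iff hε, lorentzSq, add_sub_cancel_left, norm_smul, Real.norm_eq_abs, abs_of_pos hε,
      mul_pow, div_pow, ← sub_pos, ← sub_pos (a := (1 : ℝ))]
    have : 1 - (‖y‖ ^ 2 - (u (x₀ + ε • y) - u x₀) ^ 2 / ε ^ 2) =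
        (ε ^ 2 - (ε ^ 2 * ‖y‖ ^ 2 - (u (x₀ + ε • y) - u x₀) ^ 2)) / ε ^ 2 := by
      field_simp
    rw [this, div_pos_iff_of_pos_right (by positivity)]
  set F : ℝ → E N → ℝ := fun ε y => (K u ε x₀).indicator G (x₀ + ε • y) with hF
  have hscale : ∀ ε > 0, (∫ x in K u ε x₀, G x) / ε ^ N = ∫ y, F ε y := by
    intro ε hε
    rw [← integral_indicator (measurableSet_K hu ε), ← integral_add_left_eq_self _ x₀]
    have := Measure.integral_comp_smul (volume : Measure (E N))
      (fun z => (K u ε x₀).indicator G (x₀ + z)) ε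
    rw [finrank_euclideanSpace_fin, abs_of_pos (by positivity), smul_eq_mul] at this
    rw [hF, this]
    ring
  have hlim : Tendsto (fun ε => ∫ y, F ε y) (𝓝[>] 0)
      (𝓝 (∫ y, {y : E N | ‖y‖ ^ 2 - inner ℝ a y ^ 2 < 1}.indicator (fun _ => G x₀) y)) := by
    refine tendsto_integral_filter_of_dominated_convergence
      ((Metric.closedBall (0 : E N) C).indicator fun _ => M) ?_ ?_ ?_ ?_
    · refine Eventually.of_forall fun ε => ?_
      have hm : Measurable fun x => (K u ε x₀).indicator G x :=
        hG.measurable.indicator (measurableSet_K hu ε)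
      exact (hm.comp (by fun_prop : Measurable fun y : E N => x₀ + ε • y)).aestronglyMeasurable
    · filter_upwards [Ioo_mem_nhdsGT he] with ε hε
      refine Eventually.of_forall fun y => ?_
      have hM0 : 0 ≤ M := (norm_nonneg _).trans (hM x₀ (Metric.mem_closedBall_self hδ.le))
      by_cases hy : x₀ + ε • y ∈ K u ε x₀
      · have hy1 : ‖x₀ + ε • y - x₀‖ < δ :=
          hKe _ (lt_trans (show lorentzDist u (x₀ + ε • y) x₀ < ε from hy) hε.2)
        have hy2 := hlip _ hy1
        have hy3 := (hmem hε.1 y).1 hy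
        rw [add_sub_cancel_left, norm_smul, Real.norm_eq_abs, abs_of_pos hε.1] at hy2
        have hy4 : ((u (x₀ + ε • y) - u x₀) / ε) ^ 2 ≤ (θ * ‖y‖) ^ 2 := by
          apply sq_le_sq'
          · rw [le_div_iff₀ hε.1]
            nlinarith [abs_le.1 hy2]
          · rw [div_le_iff₀ hε.1]
            nlinarith [abs_le.1 hy2]
        have hyC : y ∈ Metric.closedBall (0 : E N) C := by
          rw [mem_closedBall_zero_iff, hC, ← one_div, le_div_iff₀ (Real.sqrt_pos.2 hθ2)]
          have h6 : (‖y‖ * Real.sqrt (1 - θ ^ 2)) ^ 2 ≤ 1 ^ 2 := by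
            rw [mul_pow, Real.sq_sqrt hθ2.le]
            nlinarith
          exact le_of_sq_le_sq h6 zero_le_one
        rw [Set.indicator_of_mem hyC, hF]
        simp only
        rw [Set.indicator_of_mem hy]
        refine hM _ ?_
        rw [Metric.mem_closedBall, dist_eq_norm]
        exact hy1.le
      · rw [hF]
        simp only
        rw [Set.indicator_of_notMem hy, norm_zero]
        exact Set.indicator_nonneg (fun _ _ => hM0) _
    · exact (integrable_indicator_iff measurableSet_closedBall).2
        (integrableOn_const measure_closedBall_lt_top.ne)
    · have hae : ∀ᵐ y : E N, ‖y‖ ^ 2 - inner ℝ a y ^ 2 ≠ 1 :=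
        measure_eq_zero_iff_ae_notMem.1 (volume_lorentz_sphere a ha1)
      filter_upwards [hae] with y hy
      have hq : Tendsto (fun ε => (u (x₀ + ε • y) - u x₀) / ε) (𝓝[>] 0) (𝓝 (inner ℝ a y)) := by
        have h1 : HasDerivAt (fun t : ℝ => u (x₀ + t • y)) (inner ℝ a y) 0 := by
          rw [← fderiv_eq_inner_gradient]
          exact hfd.hasLineDerivAt y
        have h2 := h1.tendsto_slope.mono_left (nhdsWithin_mono 0
          (fun t (ht : 0 < t) => (ht.ne' : t ∈ ({0}ᶜ : Set ℝ))))
        refine h2.congr fun t => ?_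
        rw [slope_def_field]
        simp
      have hQ : Tendsto (fun ε => ‖y‖ ^ 2 - ((u (x₀ + ε • y) - u x₀) / ε) ^ 2) (𝓝[>] 0)
          (𝓝 (‖y‖ ^ 2 - inner ℝ a y ^ 2)) := tendsto_const_nhds.sub (hq.pow 2)
      have hGl : Tendsto (fun ε : ℝ => G (x₀ + ε • y)) (𝓝[>] 0) (𝓝 (G x₀)) := by
        have : Continuous fun ε : ℝ => G (x₀ + ε • y) := by fun_prop
        have h3 := this.tendsto 0
        simp only [zero_smul, add_zero] at h3
        exact h3.mono_left nhdsWithin_le_nhds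
      rcases lt_or_gt_of_ne hy with h1 | h1
      · rw [Set.indicator_of_mem (show y ∈ {y : E N | ‖y‖ ^ 2 - inner ℝ a y ^ 2 < 1} from h1)]
        refine hGl.congr' ?_
        filter_upwards [hQ.eventually (gt_mem_nhds h1), self_mem_nhdsWithin] with ε h2 h3
        rw [hF]
        simp only
        rw [Set.indicator_of_mem ((hmem h3 y).2 h2)]
      · rw [Set.indicator_of_notMem
          (show y ∉ {y : E N | ‖y‖ ^ 2 - inner ℝ a y ^ 2 < 1} from not_lt.2 h1.le)]
        refine tendsto_const_nhds.congr' ?_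
        filter_upwards [hQ.eventually (lt_mem_nhds h1), self_mem_nhdsWithin] with ε h2 h3
        rw [hF]
        simp only
        rw [Set.indicator_of_notMem fun hm => absurd ((hmem h3 y).1 hm) (not_lt.2 h2.le)]
  have hval : ∫ y, {y : E N | ‖y‖ ^ 2 - inner ℝ a y ^ 2 < 1}.indicator (fun _ => G x₀) y =
      omega N * G x₀ / v u x₀ := by
    have hmeas : MeasurableSet {y : E N | ‖y‖ ^ 2 - inner ℝ a y ^ 2 < 1} :=
      (isOpen_lt (by fun_prop) continuous_const).measurableSet
    rw [integral_indicator hmeas, setIntegral_const, measureReal_def, volume_lorentz_ball a ha1,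
      v, smul_eq_mul]
    ring
  rw [← hval]
  refine hlim.congr' ?_
  filter_upwards [self_mem_nhdsWithin] with ε hε
  exact (hscale ε hε).symm

end Density

/-! ### A singular nonlinear Gronwall inequality -/

section Gronwall

lemma intervalIntegrable_rpow_neg_mul {β B S : ℝ} (hβ : β < 1) (hS : 0 ≤ S) {f : ℝ → ℝ}
    (hf : AEStronglyMeasurable f (volume.restrict (Set.Ioc 0 S)))
    (hfB : ∀ σ ∈ Set.Ioc 0 S, |f σ| ≤ B) :
    IntervalIntegrable (fun σ => σ ^ (-β) * f σ) volume 0 S := by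
  have h1 : IntervalIntegrable (fun σ : ℝ => σ ^ (-β)) volume 0 S :=
    intervalIntegral.intervalIntegrable_rpow' (by linarith)
  rw [intervalIntegrable_iff_integrableOn_Ioc_of_le hS] at h1 ⊢
  exact h1.mul_bdd hf ((ae_restrict_mem measurableSet_Ioc).mono hfB)

/-- A nonlinear Gronwall inequality with the singular weight `σ^(-β)`. -/
lemma rpow_le_of_le_integral {D : ℝ → ℝ} {a k p β B S : ℝ} (ha : 0 < a) (hk : 0 ≤ k)
    (hp0 : 0 ≤ p) (hp1 : p < 1) (hβ : β < 1) (hS : 0 < S) (hD : Measurable D)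
    (hD0 : ∀ s ∈ Set.Ioc 0 S, 0 ≤ D s) (hDB : ∀ s ∈ Set.Ioc 0 S, D s ≤ B)
    (h : ∀ s ∈ Set.Ioc 0 S, D s ≤ a + k * ∫ σ in (0 : ℝ)..s, σ ^ (-β) * D σ ^ p) :
    D S ^ (1 - p) ≤ a ^ (1 - p) + (1 - p) * k * (S ^ (1 - β) / (1 - β)) := by
  have i1 : IntervalIntegrable (fun σ => σ ^ (-β) * D σ ^ p) volume 0 S := by
    refine intervalIntegrable_rpow_neg_mul (B := B ^ p) hβ hS.le
      (hD.pow_const p).aestronglyMeasurable fun σ hσ => ?_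
    rw [abs_of_nonneg (Real.rpow_nonneg (hD0 σ hσ) _)]
    exact Real.rpow_le_rpow (hD0 σ hσ) (hDB σ hσ) hp0
  set G : ℝ → ℝ := fun s => a + k * ∫ σ in (0 : ℝ)..s, σ ^ (-β) * D σ ^ p with hG
  have hGc : ContinuousOn G (Set.Icc 0 S) := by
    have := intervalIntegral.continuousOn_primitive_interval' i1 Set.left_mem_uIcc
    rw [Set.uIcc_of_le hS.le] at this
    exact continuousOn_const.add (continuousOn_const.mul this)
  have hGa : ∀ s ∈ Set.Icc 0 S, a ≤ G s := by
    intro s hs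
    have : 0 ≤ ∫ σ in (0 : ℝ)..s, σ ^ (-β) * D σ ^ p := by
      rw [intervalIntegral.integral_of_le hs.1]
      refine setIntegral_nonneg measurableSet_Ioc fun σ hσ => ?_
      exact mul_nonneg (Real.rpow_nonneg hσ.1.le _)
        (Real.rpow_nonneg (hD0 σ ⟨hσ.1, hσ.2.trans hs.2⟩) _)
    have := mul_nonneg hk this
    simp only [hG]
    linarith
  have hGp : ContinuousOn (fun s => G s ^ p) (Set.Icc 0 S) :=
    hGc.rpow_const fun s hs => Or.inl (ha.trans_le (hGa s hs)).ne'
  obtain ⟨M, hM⟩ := isCompact_Icc.exists_bound_of_continuousOn hGp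
  have i2 : IntervalIntegrable (fun σ => σ ^ (-β) * G σ ^ p) volume 0 S := by
    refine intervalIntegrable_rpow_neg_mul (B := M) hβ hS.le ?_ fun σ hσ =>
      hM σ (Set.Ioc_subset_Icc_self hσ)
    exact (hGp.mono Set.Ioc_subset_Icc_self).aestronglyMeasurable measurableSet_Ioc
  -- As `D` is merely measurable, `G` need not be differentiable. Replacing `D` by the continuous
  -- majorant `G` under the integral gives `G₂ ≥ G`, differentiable on `(0, S)`.
  set G₂ : ℝ → ℝ := fun s => a + k * ∫ σ in (0 : ℝ)..s, σ ^ (-β) * G σ ^ p with hG₂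
  have hG₂c : ContinuousOn G₂ (Set.Icc 0 S) := by
    have := intervalIntegral.continuousOn_primitive_interval' i2 Set.left_mem_uIcc
    rw [Set.uIcc_of_le hS.le] at this
    exact continuousOn_const.add (continuousOn_const.mul this)
  have hGG₂ : ∀ s ∈ Set.Icc 0 S, G s ≤ G₂ s := by
    intro s hs
    have hsub : Set.uIcc 0 s ⊆ Set.uIcc 0 S := by
      rw [Set.uIcc_of_le hs.1, Set.uIcc_of_le hS.le]
      exact Set.Icc_subset_Icc_right hs.2
    have : ∫ σ in (0 : ℝ)..s, σ ^ (-β) * D σ ^ p ≤ ∫ σ in (0 : ℝ)..s, σ ^ (-β) * G σ ^ p := by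
      refine intervalIntegral.integral_mono_on_of_le_Ioo hs.1 (i1.mono_set hsub)
        (i2.mono_set hsub) fun σ hσ => ?_
      have hσ' : σ ∈ Set.Ioc 0 S := ⟨hσ.1, hσ.2.le.trans hs.2⟩
      exact mul_le_mul_of_nonneg_left (Real.rpow_le_rpow (hD0 σ hσ') (h σ hσ') hp0)
        (Real.rpow_nonneg hσ.1.le _)
    simp only [hG₂]
    have := mul_le_mul_of_nonneg_left this hk
    linarith
  have hpos : ∀ s ∈ Set.Icc 0 S, 0 < G₂ s := fun s hs =>
    ha.trans_le ((hGa s hs).trans (hGG₂ s hs))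
  -- Since `G ≤ G₂`, the derivative of `G₂^(1-p)` is at most `(1 - p) k s^(-β)`, so `Z` is
  -- nondecreasing. Positivity of `a` keeps `G₂` away from the singularity of the powers.
  set Z : ℝ → ℝ := fun s => (1 - p) * k * (s ^ (1 - β) / (1 - β)) - G₂ s ^ (1 - p) with hZ
  have hZd : ∀ s ∈ Set.Ioo 0 S, HasDerivAt Z ((1 - p) * k * s ^ (-β)
      - (1 - p) * G₂ s ^ (-p) * (k * (s ^ (-β) * G s ^ p))) s := by
    intro s hs
    have hs' : s ∈ Set.Icc 0 S := Set.Ioo_subset_Icc_self hs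
    have hnhds : Set.Icc 0 S ∈ 𝓝 s := Icc_mem_nhds hs.1 hs.2
    have hcont : ContinuousAt (fun σ => σ ^ (-β) * G σ ^ p) s :=
      (Real.continuousAt_rpow_const _ _ (Or.inl hs.1.ne')).mul (hGp.continuousAt hnhds)
    have hmeas : StronglyMeasurableAtFilter (fun σ => σ ^ (-β) * G σ ^ p) (𝓝 s) volume := by
      refine ⟨Set.Ioc 0 S, Ioc_mem_nhds hs.1 hs.2, ?_⟩
      have := (intervalIntegrable_iff_integrableOn_Ioc_of_le hS.le).1 i2
      exact this.aestronglyMeasurable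
    have hsub : Set.uIcc 0 s ⊆ Set.uIcc 0 S := by
      rw [Set.uIcc_of_le hs'.1, Set.uIcc_of_le hS.le]
      exact Set.Icc_subset_Icc_right hs'.2
    have d1 : HasDerivAt G₂ (k * (s ^ (-β) * G s ^ p)) s :=
      ((intervalIntegral.integral_hasDerivAt_right (i2.mono_set hsub) hmeas hcont).const_mul
        k).const_add a
    have d2 := d1.rpow_const (p := 1 - p) (Or.inl (hpos s hs').ne')
    have d3 := (((Real.hasDerivAt_rpow_const (p := 1 - β) (Or.inl hs.1.ne')).div_const
      (1 - β)).const_mul ((1 - p) * k)).sub d2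
    refine d3.congr_deriv ?_
    have e1 : 1 - p - 1 = -p := by ring
    have e2 : 1 - β - 1 = -β := by ring
    have e3 : 1 - β ≠ 0 := by linarith
    rw [e1, e2]
    field_simp
  have hmono : MonotoneOn Z (Set.Icc 0 S) := by
    refine monotoneOn_of_deriv_nonneg (convex_Icc 0 S) ?_ ?_ ?_
    · refine ContinuousOn.sub ?_ (hG₂c.rpow_const fun s hs => Or.inl (hpos s hs).ne')
      refine continuousOn_const.mul (ContinuousOn.div_const ?_ _)
      exact continuousOn_id.rpow_const fun s _ => Or.inr (by linarith)
    · rw [interior_Icc]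
      exact fun s hs => (hZd s hs).differentiableAt.differentiableWithinAt
    · rw [interior_Icc]
      intro s hs
      have hs' : s ∈ Set.Icc 0 S := Set.Ioo_subset_Icc_self hs
      rw [(hZd s hs).deriv]
      have h1 : G s ^ p ≤ G₂ s ^ p :=
        Real.rpow_le_rpow (ha.le.trans (hGa s hs')) (hGG₂ s hs') hp0
      have h2 : G₂ s ^ (-p) * G s ^ p ≤ 1 := by
        rw [Real.rpow_neg (hpos s hs').le, inv_mul_le_iff₀ (Real.rpow_pos_of_pos (hpos s hs') _),
          mul_one]
        exact h1
      have h3 : 0 ≤ (1 - p) * k * s ^ (-β) :=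
        mul_nonneg (mul_nonneg (by linarith) hk) (Real.rpow_nonneg hs.1.le _)
      have h4 := mul_le_mul_of_nonneg_left h2 h3
      linarith
  have hfin := hmono (Set.left_mem_Icc.2 hS.le) (Set.right_mem_Icc.2 hS.le) hS.le
  have hZ0 : Z 0 = -a ^ (1 - p) := by
    simp only [hZ, hG₂]
    rw [Real.zero_rpow (by linarith), intervalIntegral.integral_same]
    simp
  rw [hZ0] at hfin
  have hS' : S ∈ Set.Ioc 0 S := ⟨hS, le_rfl⟩
  have hDS : D S ^ (1 - p) ≤ G₂ S ^ (1 - p) :=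
    Real.rpow_le_rpow (hD0 S hS') ((h S hS').trans (hGG₂ S ⟨hS.le, le_rfl⟩)) (by linarith)
  simp only [hZ] at hfin
  linarith

end Gronwall

/-! ### The density ratio and Hölder's inequality -/

section Density

variable {u ρ : E N → ℝ} {x₀ : E N} {q β R : ℝ}

/-- The volume, with respect to the measure of the graph, of the Lorentz ball. -/
def lorentzVolume (u : E N → ℝ) (x₀ : E N) (s : ℝ) : ℝ := ∫ x in K u s x₀, v u x

/-- The density ratio of the Lorentz ball. -/
def density (u : E N → ℝ) (x₀ : E N) (s : ℝ) : ℝ := lorentzVolume u x₀ s / s ^ N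

lemma continuous_v (hs : StrictlySpacelike u) : Continuous (v u) := by
  have h1 : Continuous (gradient u) :=
    (LinearIsometryEquiv.continuous _).comp (hs.contDiff.continuous_fderiv (by simp))
  unfold v
  fun_prop

lemma lorentzVolume_nonneg (s : ℝ) : 0 ≤ lorentzVolume u x₀ s :=
  integral_nonneg fun _ => Real.sqrt_nonneg _

lemma monotone_lorentzVolume (hs : StrictlySpacelike u)
    (h0 : Tendsto u (cocompact (E N)) (𝓝 0)) : Monotone (lorentzVolume u x₀) := by
  intro s t hst
  rcases le_or_gt t 0 with ht | ht
  · have hempty : ∀ r ≤ 0, K u r x₀ = ∅ := fun r hr => by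
      ext x
      simpa [K, lorentzDist] using hr.trans (Real.sqrt_nonneg _)
    rw [lorentzVolume, lorentzVolume, hempty s (hst.trans ht), hempty t ht]
  · refine setIntegral_mono_set (integrableOn_K hs.contDiff.continuous h0 ht (continuous_v hs))
      (Eventually.of_forall fun _ => Real.sqrt_nonneg _) (Eventually.of_forall fun x hx => ?_)
    exact lt_of_lt_of_le (show lorentzDist u x x₀ < s from hx) hst

lemma measurable_density (hs : StrictlySpacelike u) (h0 : Tendsto u (cocompact (E N)) (𝓝 0)) :
    Measurable (density u x₀) :=
  (monotone_lorentzVolume hs h0).measurable.div (by fun_prop)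

lemma density_nonneg {s : ℝ} (hs : 0 ≤ s) : 0 ≤ density u x₀ s :=
  div_nonneg (lorentzVolume_nonneg s) (by positivity)

/-- Near 0 the density converges; away from 0 the volume is monotone. The bound is only qualitative:
it makes the singular integrals finite. -/
lemma exists_density_le (hs : StrictlySpacelike u) (h0 : Tendsto u (cocompact (E N)) (𝓝 0))
    (R : ℝ) : ∃ B, ∀ s ∈ Set.Ioc 0 R, density u x₀ s ≤ B := by
  have h1 := tendsto_integral_K_div (x₀ := x₀) hs h0 (continuous_v hs)
  have h2 : ∀ᶠ s in 𝓝[>] 0, density u x₀ s < omega N * v u x₀ / v u x₀ + 1 :=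
    h1.eventually (gt_mem_nhds (by linarith))
  obtain ⟨e, he, h3⟩ := mem_nhdsGT_iff_exists_Ioo_subset.1 h2
  refine ⟨max (omega N * v u x₀ / v u x₀ + 1) (lorentzVolume u x₀ R / e ^ N), fun s hs' => ?_⟩
  rcases lt_or_ge s e with h | h
  · exact (le_of_lt (h3 ⟨hs'.1, h⟩)).trans (le_max_left _ _)
  · refine le_trans ?_ (le_max_right _ _)
    have he' : 0 < e := he
    exact div_le_div₀ (lorentzVolume_nonneg R) (monotone_lorentzVolume hs h0 hs'.2) (by positivity)
      (by gcongr)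

lemma intervalIntegrable_density (hs : StrictlySpacelike u)
    (h0 : Tendsto u (cocompact (E N)) (𝓝 0)) (hβ : β < 1) {p : ℝ} (hp : 0 ≤ p) (hR : 0 ≤ R) :
    IntervalIntegrable (fun σ => σ ^ (-β) * density u x₀ σ ^ p) volume 0 R := by
  obtain ⟨B, hB⟩ := exists_density_le (x₀ := x₀) hs h0 R
  refine intervalIntegrable_rpow_neg_mul (B := B ^ p) hβ hR
    ((measurable_density hs h0).pow_const p).aestronglyMeasurable fun σ hσ => ?_
  have := density_nonneg (u := u) (x₀ := x₀) hσ.1.le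
  rw [abs_of_nonneg (Real.rpow_nonneg this _)]
  exact Real.rpow_le_rpow this (hB σ hσ) hp

/-- Hölder for `ρ²` and `v` with exponents `q/2` and `q/(q-2)`; since `v ≤ 1`, the power
`v^(q/(q-2))` is at most `v`, which brings back the Lorentz volume. -/
lemma integral_v_mul_sq_le (hs : StrictlySpacelike u) (h0 : Tendsto u (cocompact (E N)) (𝓝 0))
    (hq : 2 < q) (hρ : MemLp ρ (ENNReal.ofReal q) volume) (hR : 0 < R) :
    ∫ x in K u R x₀, v u x * ρ x ^ 2 ≤
      (eLpNorm ρ (ENNReal.ofReal q) volume).toReal ^ 2 * lorentzVolume u x₀ R ^ (1 - 2 / q) := by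
  have hv0 : ∀ x, 0 ≤ v u x := fun _ => Real.sqrt_nonneg _
  have hvc := continuous_v hs
  have hq0 : 0 < q := by linarith
  have hvol : volume (K u R x₀) < ⊤ :=
    (measure_mono fun x hx => ((mem_K_iff hR).1 hx).le).trans_lt
      (isCompact_lorentzSq_le (x₀ := x₀) hs.contDiff.continuous h0 (R ^ 2)).measure_lt_top
  have hconj : (q / 2).HolderConjugate (q / (q - 2)) := by
    rw [Real.holderConjugate_iff]
    refine ⟨by linarith, ?_⟩
    have : q - 2 ≠ 0 := by linarith
    field_simp
    ring
  have hρ2 : MemLp (fun x => ρ x ^ 2) (ENNReal.ofReal (q / 2)) (volume.restrict (K u R x₀)) := by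
    have h1 := (hρ.restrict (K u R x₀)).norm_rpow_div (ENNReal.ofReal 2)
    rw [← ENNReal.ofReal_div_of_pos two_pos] at h1
    simpa using h1
  have hvm : MemLp (v u) (ENNReal.ofReal (q / (q - 2))) (volume.restrict (K u R x₀)) := by
    have : IsFiniteMeasure (volume.restrict (K u R x₀)) := ⟨by simpa using hvol⟩
    refine MemLp.of_bound hvc.aestronglyMeasurable 1 (Eventually.of_forall fun x => ?_)
    rw [Real.norm_eq_abs, abs_of_nonneg (hv0 x)]
    exact v_le_one
  have hH := integral_mul_le_Lp_mul_Lq_of_nonneg (μ := volume.restrict (K u R x₀)) hconj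
    (Eventually.of_forall fun x => sq_nonneg (ρ x)) (Eventually.of_forall hv0) hρ2 hvm
  have e1 : ∀ x, (ρ x ^ 2) ^ (q / 2) = ‖ρ x‖ ^ q := fun x => by
    rw [← sq_abs, ← Real.rpow_natCast, ← Real.rpow_mul (abs_nonneg _), Real.norm_eq_abs]
    congr 1
    push_cast
    ring
  simp_rw [e1] at hH
  have hint : Integrable (fun x => ‖ρ x‖ ^ q) := by
    have := hρ.integrable_norm_rpow (by simpa using hq0) ENNReal.ofReal_ne_top
    rwa [ENNReal.toReal_ofReal hq0.le] at this
  have hA : (∫ x in K u R x₀, ‖ρ x‖ ^ q) ^ (1 / (q / 2)) ≤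
      (eLpNorm ρ (ENNReal.ofReal q) volume).toReal ^ 2 := by
    have h1 : (eLpNorm ρ (ENNReal.ofReal q) volume).toReal = (∫ x, ‖ρ x‖ ^ q) ^ q⁻¹ := by
      rw [hρ.eLpNorm_eq_integral_rpow_norm (by simpa using hq0) ENNReal.ofReal_ne_top,
        ENNReal.toReal_ofReal hq0.le, ENNReal.toReal_ofReal]
      exact Real.rpow_nonneg (integral_nonneg fun _ => Real.rpow_nonneg (norm_nonneg _) _) _
    have h2 : 0 ≤ ∫ x, ‖ρ x‖ ^ q :=
      integral_nonneg fun _ => Real.rpow_nonneg (norm_nonneg _) _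
    rw [h1, ← Real.rpow_natCast, ← Real.rpow_mul h2]
    have h3 : 1 / (q / 2) = q⁻¹ * (2 : ℕ) := by
      push_cast
      field_simp
    rw [h3]
    refine Real.rpow_le_rpow (integral_nonneg fun _ => Real.rpow_nonneg (norm_nonneg _) _) ?_
      (by positivity)
    exact setIntegral_le_integral hint (Eventually.of_forall fun _ =>
      Real.rpow_nonneg (norm_nonneg _) _)
  have hB : (∫ x in K u R x₀, v u x ^ (q / (q - 2))) ^ (1 / (q / (q - 2))) ≤
      lorentzVolume u x₀ R ^ (1 - 2 / q) := by
    have h3 : 1 / (q / (q - 2)) = 1 - 2 / q := by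
      field_simp
    have h4 : 0 ≤ 1 - 2 / q := by
      rw [sub_nonneg, div_le_one hq0]
      exact hq.le
    rw [h3]
    refine Real.rpow_le_rpow (integral_nonneg fun x => Real.rpow_nonneg (hv0 x) _) ?_ h4
    refine integral_mono_of_nonneg (Eventually.of_forall fun x => Real.rpow_nonneg (hv0 x) _)
      (integrableOn_K hs.contDiff.continuous h0 hR hvc) (Eventually.of_forall fun x => ?_)
    refine (Real.rpow_le_rpow_of_exponent_ge (v_pos (hs.norm_gradient_lt x)) v_le_one
      (y := q / (q - 2)) (z := 1) ?_).trans_eq (Real.rpow_one _)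
    rw [one_le_div (by linarith)]
    linarith
  calc ∫ x in K u R x₀, v u x * ρ x ^ 2 = ∫ x in K u R x₀, ρ x ^ 2 * v u x := by
        simp_rw [mul_comm]
    _ ≤ _ := hH
    _ ≤ _ := mul_le_mul hA hB
      (Real.rpow_nonneg (integral_nonneg fun x => Real.rpow_nonneg (hv0 x) _) _) (sq_nonneg _)

end Density

/-! ### The estimate on a Lorentz ball and the bound for the density -/

section BallEstimate

variable {u ρ : E N → ℝ} {x₀ : E N} {q β γ R : ℝ}

lemma meanCurv_sq (hsol : SolvesBI ρ u) (x : E N) : meanCurv u x ^ 2 = ρ x ^ 2 := by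
  rw [meanCurv_eq_neg, hsol.eqn, neg_sq]

lemma integral_meanCurv_sq_le (hu : ContDiff ℝ 3 u) (hs : StrictlySpacelike u)
    (hsol : SolvesBI ρ u) (hN : 1 ≤ N) (hq : 2 * (N : ℝ) < q)
    (hρ : MemLp ρ (ENNReal.ofReal q) volume) (hρc : Continuous ρ) (hβ : β = 2 * (N : ℝ) / q)
    (hγ : 0 ≤ γ) {σ : ℝ} (hσ : 0 < σ) :
    (σ ^ N)⁻¹ * ∫ x in K u σ x₀, v u x ^ (γ + 1) * meanCurv u x ^ 2 ≤
      (eLpNorm ρ (ENNReal.ofReal q) volume).toReal ^ 2 *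
        (σ ^ (-β) * density u x₀ σ ^ (1 - 2 / q)) := by
  have hN' : (1 : ℝ) ≤ N := by exact_mod_cast hN
  have hq0 : 0 < q := by linarith
  have h1 : ∫ x in K u σ x₀, v u x ^ (γ + 1) * meanCurv u x ^ 2 ≤
      ∫ x in K u σ x₀, v u x * ρ x ^ 2 := by
    refine integral_mono_of_nonneg (Eventually.of_forall fun x => ?_)
      (integrableOn_K hu.continuous hsol.decay hσ ((continuous_v hs).mul (hρc.pow 2)))
      (Eventually.of_forall fun x => ?_)
    · exact mul_nonneg (Real.rpow_nonneg (v_pos (hs.norm_gradient_lt x)).le _) (sq_nonneg _)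
    · simp only [meanCurv_sq hsol]
      refine mul_le_mul_of_nonneg_right ?_ (sq_nonneg _)
      exact (Real.rpow_le_rpow_of_exponent_ge (v_pos (hs.norm_gradient_lt x)) v_le_one
        (z := 1) (by linarith)).trans_eq (Real.rpow_one _)
  have h2 := integral_v_mul_sq_le (x₀ := x₀) hs hsol.decay (by linarith) hρ hσ
  have h3 : (σ ^ N)⁻¹ * lorentzVolume u x₀ σ ^ (1 - 2 / q) =
      σ ^ (-β) * density u x₀ σ ^ (1 - 2 / q) := by
    rw [density, Real.div_rpow (lorentzVolume_nonneg σ) (by positivity), ← Real.rpow_natCast,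
      ← Real.rpow_mul hσ.le, ← Real.rpow_neg hσ.le]
    -- Passing from volume to density leaves the exponent `-N + N(1 - 2/q) = -2N/q = -β`.
    have : σ ^ (-(N : ℝ)) = σ ^ (-β) * σ ^ (-(N * (1 - 2 / q))) := by
      rw [← Real.rpow_add hσ, hβ]
      congr 1
      field_simp
      ring
    rw [this, Real.rpow_neg hσ.le (N * (1 - 2 / q))]
    ring
  rw [← h3]
  have h4 : 0 ≤ (σ ^ N)⁻¹ := by positivity
  calc _ ≤ (σ ^ N)⁻¹ * _ := mul_le_mul_of_nonneg_left (h1.trans h2) h4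
    _ = _ := by ring

/-- The limit `ε → 0` of `local_estimate`: `P` vanishes at `x₀`, so the average over `K_ε` tends to
`ω_N v^γ(x₀)`. The case `γ = 0` is included because it also controls the density. -/
lemma ball_estimate (hu : ContDiff ℝ 3 u) (hs : StrictlySpacelike u)
    (hsol : SolvesBI ρ u) (hN : 1 ≤ N) (hq : 2 * (N : ℝ) < q)
    (hρ : MemLp ρ (ENNReal.ofReal q) volume) (hρc : Continuous ρ) (hβ : β = 2 * (N : ℝ) / q)
    (hγ : 0 ≤ γ) (hγN : 16 * N * γ ≤ 1) (hR : 0 < R) :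
    Real.exp (-γ / 4) / R ^ N * (∫ x in K u R x₀, v u x ^ (γ + 1))
      + γ ^ 2 * (5 / 128 * (R ^ 2 / R ^ N) * Real.exp (-γ / 4)) *
        (∫ x in K u (R / 2) x₀, v u x ^ (γ + 1) * secondFormSq u x) ≤
    omega N * v u x₀ ^ γ + cRho q ρ * R *
      ∫ σ in (0 : ℝ)..R, σ ^ (-β) * density u x₀ σ ^ (1 - 2 / q) := by
  have hN' : (1 : ℝ) ≤ N := by exact_mod_cast hN
  have hq0 : 0 < q := by linarith
  have hβ1 : β < 1 := by rw [hβ, div_lt_one hq0]; exact hq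
  have hp0 : 0 ≤ 1 - 2 / q := by
    rw [sub_nonneg, div_le_one hq0]
    linarith
  have hg := hs.norm_gradient_lt
  have hI := intervalIntegrable_density (x₀ := x₀) hs hsol.decay hβ1 hp0 hR.le
  have c1 := (contDiff_v_rpow hu hg (γ + 1)).continuous
  have c2 := (contDiff_meanCurv hu hg).continuous
  have c3 := continuous_normalPart (x₀ := x₀) hu hg
  have hP0 : normalPart u x₀ x₀ = 0 := by simp [normalPart, supportFn]
  have hlim := tendsto_integral_K_div (x₀ := x₀) hs hsol.decay
    (G := fun x => v u x ^ (γ + 1) * (1 + 2 * |meanCurv u x * normalPart u x₀ x|)) (by fun_prop)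
  have hval : omega N * (v u x₀ ^ (γ + 1) * (1 + 2 * |meanCurv u x₀ * normalPart u x₀ x₀|))
      / v u x₀ = omega N * v u x₀ ^ γ := by
    have := v_pos (hg x₀)
    rw [hP0, Real.rpow_add_one this.ne']
    simp
    field_simp
  rw [hval] at hlim
  refine ge_of_tendsto (hlim.add_const _) ?_
  filter_upwards [Ioo_mem_nhdsGT (half_pos hR)] with ε hε
  have hεR : ε ≤ R := by linarith [hε.2]
  refine (local_estimate hu hs hsol.decay hN hγ hγN hR hε.1 hε.2).trans ?_
  refine add_le_add le_rfl ?_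
  set A := (eLpNorm ρ (ENNReal.ofReal q) volume).toReal with hA
  have i1 : IntervalIntegrable (fun σ => A ^ 2 * (σ ^ (-β) * density u x₀ σ ^ (1 - 2 / q)))
      volume 0 R := hI.const_mul _
  have h1 : ∫ σ in ε..R, (σ ^ N)⁻¹ * ∫ x in K u σ x₀, v u x ^ (γ + 1) * meanCurv u x ^ 2 ≤
      ∫ σ in ε..R, A ^ 2 * (σ ^ (-β) * density u x₀ σ ^ (1 - 2 / q)) := by
    refine intervalIntegral.integral_mono_on hεR
      (layer_cake (x₀ := x₀) hu.continuous hsol.decay hε.1 hεR (c1.mul (c2.pow 2)) N).2.1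
      (i1.mono_set ?_) fun σ hσ => integral_meanCurv_sq_le hu hs hsol hN hq hρ hρc hβ hγ
        (hε.1.trans_le hσ.1)
    rw [Set.uIcc_of_le hεR, Set.uIcc_of_le hR.le]
    exact Set.Icc_subset_Icc_left hε.1.le
  have h2 : ∫ σ in ε..R, A ^ 2 * (σ ^ (-β) * density u x₀ σ ^ (1 - 2 / q)) ≤
      ∫ σ in (0 : ℝ)..R, A ^ 2 * (σ ^ (-β) * density u x₀ σ ^ (1 - 2 / q)) := by
    refine intervalIntegral.integral_mono_interval hε.1.le hεR le_rfl ?_ i1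
    filter_upwards [ae_restrict_mem measurableSet_Ioc] with σ hσ
    exact mul_nonneg (sq_nonneg _) (mul_nonneg (Real.rpow_nonneg hσ.1.le _)
      (Real.rpow_nonneg (density_nonneg hσ.1.le) _))
  rw [intervalIntegral.integral_const_mul (μ := volume) (a := 0)] at h2
  have h3 := mul_le_mul_of_nonneg_left (h1.trans h2) (by positivity : 0 ≤ 9 / 4 * R)
  rw [cRho, ← hA]
  linarith

/-- Gronwall with `p = 1 - 2/q` bounds `D^(2/q)`; raising to the power `(q-2)/2` gives exactly the
power `1 - 2/q` of `D` in the error term. -/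
lemma density_rpow_le (hu : ContDiff ℝ 3 u) (hs : StrictlySpacelike u)
    (hsol : SolvesBI ρ u) (hN : 1 ≤ N) (hq : 2 * (N : ℝ) < q)
    (hρ : MemLp ρ (ENNReal.ofReal q) volume) (hρc : Continuous ρ) (hβ : β = 2 * (N : ℝ) / q)
    {S : ℝ} (hS : 0 < S) :
    density u x₀ S ^ (1 - 2 / q) ≤ (2 / q) ^ ((q - 2) / 2) *
      (q / 2 * omega N ^ (2 / q) + cRho q ρ / (1 - β) * S ^ (2 - β)) ^ ((q - 2) / 2) := by
  have hN' : (1 : ℝ) ≤ N := by exact_mod_cast hN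
  have hq0 : 0 < q := by linarith
  have hβ1 : β < 1 := by rw [hβ, div_lt_one hq0]; exact hq
  have hp0 : 0 ≤ 1 - 2 / q := by
    rw [sub_nonneg, div_le_one hq0]
    linarith
  have hp1 : 1 - 2 / q < 1 := by
    have : 0 < 2 / q := by positivity
    linarith
  have hc : 0 ≤ cRho q ρ := by unfold cRho; positivity
  have hω := omega_pos N
  obtain ⟨B, hB⟩ := exists_density_le (x₀ := x₀) hs hsol.decay S
  have h := rpow_le_of_le_integral (D := density u x₀) (k := cRho q ρ * S) hω
    (by positivity) hp0 hp1 hβ1 hS (measurable_density hs hsol.decay)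
    (fun s hs' => density_nonneg hs'.1.le) hB fun s hs' => ?_
  · have e1 : 1 - (1 - 2 / q) = 2 / q := by ring
    rw [e1] at h
    have hD := density_nonneg (u := u) (x₀ := x₀) hS.le
    have e2 : omega N ^ (2 / q) + 2 / q * (cRho q ρ * S) * (S ^ (1 - β) / (1 - β)) =
        2 / q * (q / 2 * omega N ^ (2 / q) + cRho q ρ / (1 - β) * S ^ (2 - β)) := by
      have : S ^ (2 - β) = S * S ^ (1 - β) := by
        rw [show 2 - β = 1 + (1 - β) by ring, Real.rpow_add hS, Real.rpow_one]
      rw [this]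
      field_simp
    rw [e2] at h
    have h0 : 0 ≤ q / 2 * omega N ^ (2 / q) + cRho q ρ / (1 - β) * S ^ (2 - β) := by
      have : 0 ≤ 1 - β := by linarith
      positivity
    rw [← Real.mul_rpow (by positivity) h0]
    have e3 : density u x₀ S ^ (1 - 2 / q) = (density u x₀ S ^ (2 / q)) ^ ((q - 2) / 2) := by
      rw [← Real.rpow_mul hD]
      congr 1
      field_simp
    rw [e3]
    exact Real.rpow_le_rpow (Real.rpow_nonneg hD _) h (by linarith)
  -- For `γ = 0` the curvature term drops out and the left side is the density itself. The prefactor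
  -- `s` is then enlarged to `S`, to have a constant in front of the integral.
  · have h1 := ball_estimate (x₀ := x₀) hu hs hsol hN hq hρ hρc hβ (γ := 0) le_rfl (by simp) hs'.1
    simp only [neg_zero, zero_div, Real.exp_zero, zero_add, Real.rpow_one, Real.rpow_zero,
      mul_one, ne_eq, OfNat.ofNat_ne_zero, not_false_eq_true, zero_pow, zero_mul, add_zero] at h1
    have h2 : density u x₀ s = 1 / s ^ N * ∫ x in K u s x₀, v u x := by
      rw [density, lorentzVolume]
      ring
    rw [h2]
    refine h1.trans (add_le_add le_rfl ?_)
    refine mul_le_mul_of_nonneg_right (mul_le_mul_of_nonneg_left hs'.2 hc) ?_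
    rw [intervalIntegral.integral_of_le hs'.1.le]
    refine setIntegral_nonneg measurableSet_Ioc fun σ hσ => ?_
    exact mul_nonneg (Real.rpow_nonneg hσ.1.le _) (Real.rpow_nonneg (density_nonneg hσ.1.le) _)

lemma intervalIntegrable_errorIntegrand (hβ : β < 1) (hq : 2 ≤ q) (c : ℝ) :
    IntervalIntegrable (errorIntegrand N q β c) volume 0 R := by
  unfold errorIntegrand
  have hcont : Continuous fun s : ℝ =>
      (q / 2 * omega N ^ (2 / q) + c / (1 - β) * s ^ (2 - β)) ^ ((q - 2) / 2) := by
    have h1 : Continuous fun s : ℝ => s ^ (2 - β) := Real.continuous_rpow_const (by linarith)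
    exact (continuous_const.add (continuous_const.mul h1)).rpow_const
      fun s => Or.inr (by linarith)
  exact (intervalIntegral.intervalIntegrable_rpow' (by linarith)).mul_continuousOn
    hcont.continuousOn

end BallEstimate

end BornInfeld

end

/-! ### Choice of the constants and conclusion -/

theorem proposition3p1 (N : ℕ) (hN : 3 ≤ N) :
    ∃ γ C : ℝ, 0 < γ ∧ γ < 1 / (N : ℝ) ∧ 0 < C ∧
      ∀ (q : ℝ), 2 * (N : ℝ) < q →
      ∀ (x₀ : BornInfeld.E N) (R : ℝ), 0 < R →
      ∀ (ρ : BornInfeld.E N → ℝ), MemLp ρ (ENNReal.ofReal q) volume → ContDiff ℝ 1 ρ →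
      ∀ (u : BornInfeld.E N → ℝ), ContDiff ℝ 3 u →
        BornInfeld.StrictlySpacelike u → BornInfeld.SolvesBI ρ u →
        ∀ β : ℝ, β = 2 * (N : ℝ) / q →
        -- the three integrals below are finite
        IntegrableOn (fun x => BornInfeld.v u x ^ (γ + 1)) (BornInfeld.K u R x₀) volume ∧
        IntegrableOn (fun x => ∑ i, ∑ j, BornInfeld.partialD2 i j u x ^ 2)
          (BornInfeld.K u (R / 2) x₀) volume ∧
        IntervalIntegrable (BornInfeld.errorIntegrand N q β (BornInfeld.cRho q ρ)) volume 0 R ∧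
        -- the estimate
        BornInfeld.omega N * BornInfeld.v u x₀ ^ γ ≥
          Real.exp (-γ / 4) * R ^ (-(N : ℤ)) *
              (∫ x in BornInfeld.K u R x₀, BornInfeld.v u x ^ (γ + 1))
            - BornInfeld.cRho q ρ * R * (2 / q) ^ ((q - 2) / 2) *
              (∫ s in (0 : ℝ)..R, BornInfeld.errorIntegrand N q β (BornInfeld.cRho q ρ) s)
            + C * R ^ (2 - (N : ℤ)) * Real.exp (-γ / 4) *
              (∫ x in BornInfeld.K u (R / 2) x₀,
                ∑ i, ∑ j, BornInfeld.partialD2 i j u x ^ 2) := by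
  open BornInfeld in
  have hN1 : 1 ≤ N := by omega
  have hN' : (3 : ℝ) ≤ N := by exact_mod_cast hN
  have hN0 : (0 : ℝ) < N := by linarith
  -- The largest exponent allowed by `16 N γ ≤ 1`.
  set γ : ℝ := 1 / (16 * N) with hγ
  have hγ0 : 0 < γ := by positivity
  have hγN : 16 * N * γ ≤ 1 := by
    rw [hγ]
    field_simp
    exact le_rfl
  -- One factor `γ` of `C` is the weight of `curvField` in the test field, the other the surviving
  -- fraction of `|A|²`; `5/128` comes from `le_integral_radialKernel_second`.
  refine ⟨γ, γ ^ 2 * (5 / 128), hγ0, ?_, by positivity, ?_⟩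
  · rw [hγ]
    gcongr
    linarith
  intro q hq x₀ R hR ρ hρ hρ1 u hu hs hsol β hβ
  have hg := hs.norm_gradient_lt
  have hq0 : 0 < q := by linarith
  have hβ1 : β < 1 := by rw [hβ, div_lt_one hq0]; exact hq
  have c1 := (contDiff_v_rpow hu hg (γ + 1)).continuous
  have c2 := continuous_secondFormSq hu hg
  have c3 := continuous_partialD2 hu
  have i1 : IntegrableOn (fun x => v u x ^ (γ + 1)) (K u R x₀) volume :=
    integrableOn_K hu.continuous hsol.decay hR c1
  have i2 : IntegrableOn (fun x => ∑ i, ∑ j, partialD2 i j u x ^ 2) (K u (R / 2) x₀) volume :=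
    integrableOn_K hu.continuous hsol.decay (half_pos hR) (by fun_prop)
  have i3 : IntervalIntegrable (errorIntegrand N q β (cRho q ρ)) volume 0 R :=
    intervalIntegrable_errorIntegrand hβ1 (by linarith) _
  refine ⟨i1, i2, i3, ?_⟩
  have hmain := ball_estimate (x₀ := x₀) hu hs hsol hN1 hq hρ hρ1.continuous hβ hγ0.le hγN hR
  have hp0 : 0 ≤ 1 - 2 / q := by
    rw [sub_nonneg, div_le_one hq0]
    linarith
  have hE : ∫ σ in (0 : ℝ)..R, σ ^ (-β) * density u x₀ σ ^ (1 - 2 / q) ≤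
      (2 / q) ^ ((q - 2) / 2) * ∫ s in (0 : ℝ)..R, errorIntegrand N q β (cRho q ρ) s := by
    rw [← intervalIntegral.integral_const_mul]
    refine intervalIntegral.integral_mono_on_of_le_Ioo hR.le
      (intervalIntegrable_density hs hsol.decay hβ1 hp0 hR.le) (i3.const_mul _) fun σ hσ => ?_
    have h1 := density_rpow_le (x₀ := x₀) hu hs hsol hN1 hq hρ hρ1.continuous hβ hσ.1
    have h2 := mul_le_mul_of_nonneg_left h1 (Real.rpow_nonneg hσ.1.le (-β))
    rw [errorIntegrand]
    linarith
  have hS : ∫ x in K u (R / 2) x₀, ∑ i, ∑ j, partialD2 i j u x ^ 2 ≤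
      ∫ x in K u (R / 2) x₀, v u x ^ (γ + 1) * secondFormSq u x := by
    refine integral_mono i2 (integrableOn_K hu.continuous hsol.decay (half_pos hR) (c1.mul c2))
      fun x => sum_sq_le_rpow_mul_secondFormSq (hg x) ?_
    rw [hγ, div_le_one (by positivity)]
    linarith
  have hc : 0 ≤ cRho q ρ := by unfold cRho; positivity
  have e1 : R ^ (-(N : ℤ)) = 1 / R ^ N := by
    rw [zpow_neg, zpow_natCast, one_div]
  have e2 : R ^ (2 - (N : ℤ)) = R ^ 2 / R ^ N := by
    rw [zpow_sub₀ hR.ne', zpow_natCast]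
    norm_cast
  have h1 := mul_le_mul_of_nonneg_left hE (mul_nonneg hc hR.le)
  have h2 := mul_le_mul_of_nonneg_left hS
    (by positivity : 0 ≤ γ ^ 2 * (5 / 128 * (R ^ 2 / R ^ N) * Real.exp (-γ / 4)))
  have e3 : Real.exp (-γ / 4) * (1 / R ^ N) = Real.exp (-γ / 4) / R ^ N := by ring
  rw [e1, e2, e3, ge_iff_le]
  linarith
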